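/- Let $r\in\mathbb N$ and let $n_1,\dots,n_r$ be nonnegative integers. There is a finite constant $C>0$, depending only on $r$ and $(n_1,\dots,n_r)$, such that the following holds. Let $V$ be the disjoint union of sets $V^{(1)},\dots,V^{(r)}$ with $|V^{(i)}|=n_i$, and let $E\subseteq\prod_{i=1}^r V^{(i)}$ be an arbitrary set of edges of an $r$-partite $r$-uniform hypergraph $H=(V,E)$; thus each edge $e$ contains exactly one vertex of each part. (In particular, $H$ may be any such hypergraph whose connected components are all complete, but completeness is not required.) For $e\in E$ let $V_e^{(j)}$ be the set of vertices of $V^{(j)}$ in the connected component containing $e$, and put $$d_e:=\max_{1\le i\le r}\ \prod_{j\ne i}|V_e^{(j)}| .$$ Let $S=(S^{(i)})_{i=1}^r$ with $S^{(i)}\subseteq V^{(i)}$ be a choice of selected vertices such that $|S^{(i_0)}|\ge 2$ for some $i_0$. A dyadic cube is a set $Q=I_1\times\dots\times I_r$ with $I_i=[2^kl_i,2^k(l_i+1))$, $k,l_i\in\mathbb Z$. It has $2^r$ children, the dyadic cubes contained in it with half its side length. Let $\mathcal T$ be a finite convex tree of dyadic cubes with root $Q_{\mathcal T}$, i.e.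 $Q_{\mathcal T}\in\mathcal T$, every $Q\in\mathcal T$ is contained in $Q_{\mathcal T}$, and any dyadic cube $Q_2$ with $Q_1\subseteq Q_2\subseteq Q_3$ for some $Q_1,Q_3\in\mathcal T$ belongs to $\mathcal T$. Let $\mathcal L(\mathcal T)$ be the set of its leaves: the dyadic cubes not in $\mathcal T$ whose parent is in $\mathcal T$. For an interval $I$ with left and right halves $I_L,I_R$ put $\mathbf h^0_I=|I|^{-1}\mathbf 1_I$ and $\mathbf h^1_I=|I|^{-1}(\mathbf 1_{I_L}-\mathbf 1_{I_R})$. Let $\mathbf F=(F_e)_{e\in E}$ be a tuple of measurable functions $F_e:\mathbb R^r\to[0,\infty)$ such that $F_e^{d_e}$ is locally integrable for every $e\in E$. Put $$[\mathbf F]_{H,S,Q}:=\int_{\mathbb R^{V}}\prod_{e\in E}F_e(x_e)\ \prod_{i=1}^r\Big(\prod_{v\in S^{(i)}}\mathbf h^1_{I_i}(x_v)\prod_{v\in V^{(i)}\setminus S^{(i)}}\mathbf h^0_{I_i}(x_v)\Big)\,dx,$$ where $x=(x_v)_{v\in V}$ and $x_e=(x_{e_1},\dots,x_{e_r})$ for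 $e=(e_1,\dots,e_r)$; put $[f]_Q:=|Q|^{-1}\int_Q f$ and $$\Lambda_{\mathcal T}(\mathbf F):=\sum_{Q\in\mathcal T}|Q|\,[\mathbf F]_{H,S,Q}.$$ Then the integrals defining $[\mathbf F]_{H,S,Q}$, $Q\in\mathcal T$, converge absolutely, and $$|\Lambda_{\mathcal T}(\mathbf F)|\le C\,|Q_{\mathcal T}|\prod_{e\in E}\ \max_{Q\in\mathcal T\cup\mathcal L(\mathcal T)}[F_e^{d_e}]_Q^{1/d_e}.$$ -/

import Mathlib

open MeasureTheory

namespace DyadicForm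

/-- A dyadic cube `∏ i, [2^k * l i, 2^k * (l i + 1))` of `ℝ^r`, given by its scale `k` and its
integer coordinates `l`. -/
@[ext]
structure DyadicCube (r : ℕ) where
  scale : ℤ
  coord : Fin r → ℤ

namespace DyadicCube

variable {r : ℕ}

/-- Left endpoint of the `i`-th side of the cube. -/
noncomputable def lo (Q : DyadicCube r) (i : Fin r) : ℝ := (2 : ℝ) ^ Q.scale * (Q.coord i : ℝ)

/-- Right endpoint of the `i`-th side of the cube. -/
noncomputable def hi (Q : DyadicCube r) (i : Fin r) : ℝ :=
  (2 : ℝ) ^ Q.scale * ((Q.coord i : ℝ) + 1)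

/-- The cube as a subset of `ℝ^r`. -/
def toSet (Q : DyadicCube r) : Set (Fin r → ℝ) := {x | ∀ i, x i ∈ Set.Ico (Q.lo i) (Q.hi i)}

/-- The Lebesgue measure `|Q|`. -/
noncomputable def vol (Q : DyadicCube r) : ℝ := volume.real Q.toSet

open Classical in
/-- The `2 ^ r` children of a cube: every side `[2^k * l, 2^k * (l + 1))` is replaced by one of its
halves `[2^(k-1) * (2 * l + b), 2^(k-1) * (2 * l + b + 1))`, `b = 0, 1`. -/
noncomputable def children (Q : DyadicCube r) : Finset (DyadicCube r) :=
  Finset.univ.image fun b : Fin r → Fin 2 =>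
    ⟨Q.scale - 1, fun i => 2 * Q.coord i + ((b i : ℕ) : ℤ)⟩

end DyadicCube

/-- The finite family `T` of dyadic cubes is a convex tree with root `R`. -/
structure IsConvexTree {r : ℕ} (T : Finset (DyadicCube r)) (R : DyadicCube r) : Prop where
  root_mem : R ∈ T
  subset_root : ∀ Q ∈ T, Q.toSet ⊆ R.toSet
  convex : ∀ Q₁ ∈ T, ∀ Q₃ ∈ T, ∀ Q₂ : DyadicCube r,
    Q₁.toSet ⊆ Q₂.toSet → Q₂.toSet ⊆ Q₃.toSet → Q₂ ∈ T

open Classical in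
/-- The leaves of `T`: the cubes outside `T` whose parent belongs to `T`. -/
noncomputable def leaves {r : ℕ} (T : Finset (DyadicCube r)) : Finset (DyadicCube r) :=
  (T.biUnion DyadicCube.children) \ T

open Classical in
/-- The cubes of `T` together with its leaves. -/
noncomputable def treeAndLeaves {r : ℕ} (T : Finset (DyadicCube r)) : Finset (DyadicCube r) :=
  T ∪ leaves T

theorem IsConvexTree.treeAndLeaves_nonempty {r : ℕ} {T : Finset (DyadicCube r)}
    {R : DyadicCube r} (hT : IsConvexTree T R) : (treeAndLeaves T).Nonempty := by
  classical
  exact ⟨R, by simp [treeAndLeaves, hT.root_mem]⟩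

/-- The non-cancellative Haar function `|I|⁻¹ 1_I` of `I = [a, b)`. -/
noncomputable def haarZero (a b : ℝ) (t : ℝ) : ℝ :=
  (b - a)⁻¹ * (Set.Ico a b).indicator 1 t

/-- The cancellative Haar function `|I|⁻¹ (1_{I_L} - 1_{I_R})` of `I = [a, b)`, where `I_L` and
`I_R` are the left and right halves of `I`. -/
noncomputable def haarOne (a b : ℝ) (t : ℝ) : ℝ :=
  (b - a)⁻¹ *
    ((Set.Ico a ((a + b) / 2)).indicator 1 t - (Set.Ico ((a + b) / 2) b).indicator 1 t)

section Hypergraph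

variable {r : ℕ} {n : Fin r → ℕ}

/-- The vertices of an `r`-partite hypergraph whose `i`-th part has `n i` elements. -/
abbrev Vertex (n : Fin r → ℕ) : Type := Σ i : Fin r, Fin (n i)

/-- The possible edges of an `r`-partite `r`-uniform hypergraph: each contains exactly one vertex
from each part. The hypergraph itself is given by a finite set of edges. -/
abbrev Edge (n : Fin r → ℕ) : Type := ∀ i : Fin r, Fin (n i)

/-- Two vertices lie on a common edge. -/
def OnCommonEdge (E : Finset (Edge n)) (u v : Vertex n) : Prop :=
  ∃ e ∈ E, e u.1 = u.2 ∧ e v.1 = v.2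

/-- Two vertices lie in the same connected component of the hypergraph. -/
def SameComponent (E : Finset (Edge n)) : Vertex n → Vertex n → Prop :=
  Relation.ReflTransGen (OnCommonEdge E)

/-- The vertices of the `j`-th part lying in the connected component that contains the edge `e`.
(The vertex of `e` in the `j`-th part is `e j`.) -/
def componentPart (E : Finset (Edge n)) (e : Edge n) (j : Fin r) : Set (Fin (n j)) :=
  {v | SameComponent E ⟨j, e j⟩ ⟨j, v⟩}

/-- The threshold `d_e`: the maximum over `i` of the product over `j ≠ i` of the sizes of the
parts of the connected component containing `e`. -/
noncomputable def threshold (E : Finset (Edge n)) (e : Edge n) : ℕ :=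
  Finset.univ.sup fun i : Fin r =>
    ∏ j ∈ Finset.univ.erase i, (componentPart E e j).ncard

/-- The integrand of `[F]_{H,S,Q}`; the real variables are indexed by the vertices. -/
noncomputable def evaluationIntegrand (E : Finset (Edge n)) (S : ∀ i, Finset (Fin (n i)))
    (F : Edge n → (Fin r → ℝ) → ℝ) (Q : DyadicCube r) (x : Vertex n → ℝ) : ℝ :=
  (∏ e ∈ E, F e (fun i => x ⟨i, e i⟩)) *
    ∏ i, ((∏ v ∈ S i, haarOne (Q.lo i) (Q.hi i) (x ⟨i, v⟩)) *
      ∏ v ∈ (S i)ᶜ, haarZero (Q.lo i) (Q.hi i) (x ⟨i, v⟩))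

/-- The evaluation `[F]_{H,S,Q}` of the tuple `F` on the hypergraph with edge set `E`, with
selected vertices `S`, on the cube `Q`. -/
noncomputable def evaluation (E : Finset (Edge n)) (S : ∀ i, Finset (Fin (n i)))
    (F : Edge n → (Fin r → ℝ) → ℝ) (Q : DyadicCube r) : ℝ :=
  ∫ x : Vertex n → ℝ, evaluationIntegrand E S F Q x

/-- The tree-localized form `Λ_T(F) = ∑_{Q ∈ T} |Q| [F]_{H,S,Q}`. -/
noncomputable def treeForm (E : Finset (Edge n)) (S : ∀ i, Finset (Fin (n i)))
    (T : Finset (DyadicCube r)) (F : Edge n → (Fin r → ℝ) → ℝ) : ℝ :=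
  ∑ Q ∈ T, Q.vol * evaluation E S F Q

end Hypergraph

end DyadicForm

/-!
The proof is a Bellman function argument.

After normalizing the functions, all moments `[F_e ^ d_e]_Q` are at most one. The form of the
hypergraph on a cube is the expectation of a product, when the variables of the vertices are
independent and uniformly distributed on the sides of the cube; hence it is the product of the forms
of the connected components (`integrable_and_integral_globalIntegrand`). Each component is completed
to a complete hypergraph by inserting the constant function `1` for the missing edges, which does
not affect the thresholds.

For a complete hypergraph, consider the positive combination `bellmanForm` of the forms without
selected vertices that are obtained by relabelling the vertices within each part. Its weights are
chosen such that, as a function of the variables of any one part `i`, it is the integral over the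
other variables of the convex polynomial `bellmanPoly` of the vector `g` of the averages
`g u = fiberMean F i μ x u`, `u` running over the part `i`. Therefore it grows whenever the sides
of a cube are halved in one direction, and by quantitative convexity of `bellmanPoly` it grows at
least by `bellmanGain`, the integral of `|Δ g u| ^ 2 * (∑ g) ^ (|W i| - 2)`, where `Δ g u` is
half the difference of the corresponding averages over the two halves of the side. As one may begin
with any direction, this gain is available for all parts and vertices
(`bellmanForm_add_gain_le_sum`), and the gains are summable over the tree by telescoping
(`IsConvexTree.sum_vol_mul_le`), because the Bellman function is bounded on the cubes
of the tree and on the leaves. The boundedness follows by decomposing the complete hypergraph into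
at most `maxDegree` matchings, on each of which the functions are independent (`completeForm_le`).

* If two vertices of one part of the component are selected, the form is pointwise dominated by two
  gains, so it is absolutely summable.
* If a vertex is selected in a part with at least two vertices, the Cauchy-Schwarz inequality bounds
  the square of the form by a gain, so the form is square summable.
* If all selected vertices lie in parts with a single vertex, the forms on the children of a cube
  are the values of a function on `{1, -1} ^ r`, and the form in question is one of its Walsh
  coefficients, up to absolutely summable errors. Bessel's inequality for this coefficient and the
  mean (`sq_add_sq_le_sum_children`) telescopes, so the form is again square summable.

Two selected vertices in one part lie either in the same component, or in two components, both of
which contribute square summable factors. This proves the estimate (`exists_normalized_bound`).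
-/

namespace DyadicForm

/-! ### Product measures -/

section ProductMeasure

open ProbabilityTheory
open scoped ENNReal

theorem lintegral_pi_prod {ι : Type*} [Fintype ι] {X : ι → Type*} [∀ i, MeasurableSpace (X i)]
    (μ : ∀ i, Measure (X i)) [∀ i, IsProbabilityMeasure (μ i)] (f : ∀ i, X i → ℝ≥0∞)
    (hf : ∀ i, Measurable (f i)) :
    ∫⁻ x, ∏ i, f i (x i) ∂Measure.pi μ = ∏ i, ∫⁻ t, f i t ∂μ i := by
  rw [lintegral_prod_eq_prod_lintegral_of_indepFun Finset.univ (fun i (x : ∀ i, X i) => f i (x i))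
    (iIndepFun_pi fun i => (hf i).aemeasurable) fun i => (hf i).comp (measurable_pi_apply i)]
  exact Finset.prod_congr rfl fun i _ =>
    (measurePreserving_eval μ i).lintegral_comp (hf i)

/-- Resampling one coordinate of a product measure. -/
theorem measurePreserving_update {ι : Type*} [Fintype ι] [DecidableEq ι] {X : ι → Type*}
    [∀ i, MeasurableSpace (X i)] (ν : ∀ i, Measure (X i)) [∀ i, IsProbabilityMeasure (ν i)]
    (i : ι) (ρ : Measure (X i)) [IsProbabilityMeasure ρ] :
    MeasurePreserving (fun p : (∀ j, X j) × X i => Function.update p.1 i p.2)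
      ((Measure.pi ν).prod ρ) (Measure.pi (Function.update ν i ρ)) := by
  have hm : Measurable (fun p : (∀ j, X j) × X i => Function.update p.1 i p.2) := by
    refine measurable_pi_iff.2 fun j => ?_
    by_cases h : j = i
    · subst h; simpa using measurable_snd
    · simpa [Function.update_of_ne h, Function.comp_def] using
        (measurable_pi_apply j).comp measurable_fst
  have hp : ∀ j, IsProbabilityMeasure (Function.update ν i ρ j) := by
    intro j
    by_cases h : j = i
    · subst h; simpa
    · rw [Function.update_of_ne h]; infer_instance
  refine ⟨hm, ?_⟩
  symm
  refine Measure.pi_eq fun s hs => ?_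
  rw [Measure.map_apply hm (MeasurableSet.univ_pi hs)]
  have : (fun p : (∀ j, X j) × X i => Function.update p.1 i p.2) ⁻¹' (Set.univ.pi s)
      = (Set.univ.pi (Function.update s i Set.univ)) ×ˢ s i := by
    ext p
    simp only [Set.mem_preimage, Set.mem_pi, Set.mem_univ, true_imp_iff, Set.mem_prod]
    constructor
    · intro h
      refine ⟨fun j => ?_, by simpa using h i⟩
      by_cases hj : j = i
      · subst hj; simp
      · simpa [Function.update_of_ne hj] using h j
    · rintro ⟨h, h'⟩ j
      by_cases hj : j = i
      · subst hj; simpa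
      · simpa [Function.update_of_ne hj] using h j
  rw [this, Measure.prod_prod, Measure.pi_pi, ← Finset.mul_prod_erase _ _ (Finset.mem_univ i),
    ← Finset.mul_prod_erase _ (fun j => Function.update ν i ρ j (s j)) (Finset.mem_univ i)]
  simp only [Function.update_self, measure_univ, one_mul]
  rw [mul_comm]
  congr 1
  refine Finset.prod_congr rfl fun j hj => ?_
  have hj := Finset.ne_of_mem_erase hj
  simp [Function.update_of_ne hj]

/-- Under a product measure, families of coordinates indexed by disjoint sets of indices are
independent, and each is distributed according to a product measure. The disjoint sets are encoded
by an injective map on a sigma type. -/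
theorem measurePreserving_comp_sigma {ι κ X : Type*} [Fintype ι] [Fintype κ] [MeasurableSpace X]
    {α : κ → Type*} [∀ k, Fintype (α k)] (ν : ι → Measure X) [∀ i, IsProbabilityMeasure (ν i)]
    (φ : (Σ k, α k) → ι) (hφ : Function.Injective φ) :
    MeasurePreserving (fun (x : ι → X) k a => x (φ ⟨k, a⟩)) (Measure.pi ν)
      (Measure.pi fun k => Measure.pi fun a : α k => ν (φ ⟨k, a⟩)) := by
  classical
  have h1 : MeasurePreserving (fun (x : ι → X) p => x (φ p)) (Measure.pi ν)
      (Measure.pi fun p => ν (φ p)) := by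
    refine ⟨by fun_prop, ?_⟩
    simpa only [Measure.infinitePi_eq_pi] using
      Measure.map_infinitePi_infinitePi_of_inj (P := ν) hφ
  have h2 := Measure.infinitePi_map_piCurry (X := fun (k : κ) (_ : α k) => X)
    (fun k a => ν (φ ⟨k, a⟩))
  simp only [Measure.infinitePi_eq_pi] at h2
  exact MeasurePreserving.comp ⟨(MeasurableEquiv.piCurry _).measurable, h2⟩ h1

theorem pi_withDensity {ι : Type*} [Fintype ι] {X : ι → Type*} [∀ i, MeasurableSpace (X i)]
    (μ : ∀ i, Measure (X i)) [∀ i, IsProbabilityMeasure (μ i)] (f : ∀ i, X i → ℝ≥0∞)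
    (hf : ∀ i, Measurable (f i)) [∀ i, IsProbabilityMeasure ((μ i).withDensity (f i))] :
    Measure.pi (fun i => (μ i).withDensity (f i))
      = (Measure.pi μ).withDensity fun x => ∏ i, f i (x i) := by
  refine Measure.pi_eq fun s hs => ?_
  rw [withDensity_apply _ (MeasurableSet.univ_pi hs),
    ← lintegral_indicator (MeasurableSet.univ_pi hs)]
  have : (Set.univ.pi s).indicator (fun x => ∏ i, f i (x i))
      = fun x => ∏ i, (s i).indicator (f i) (x i) := by
    classical
    ext x
    by_cases h : x ∈ Set.univ.pi s
    · rw [Set.indicator_of_mem h]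
      exact Finset.prod_congr rfl fun i _ => (Set.indicator_of_mem (h i trivial) _).symm
    · rw [Set.indicator_of_notMem h]
      simp only [Set.mem_pi, Set.mem_univ, true_imp_iff, not_forall] at h
      obtain ⟨i, hi⟩ := h
      exact (Finset.prod_eq_zero (Finset.mem_univ i) (Set.indicator_of_notMem hi _)).symm
  rw [this, lintegral_pi_prod μ _ fun i => (hf i).indicator (hs i)]
  refine Finset.prod_congr rfl fun i _ => ?_
  rw [lintegral_indicator (hs i), withDensity_apply _ (hs i)]

end ProductMeasure

/-! ### A convex polynomial -/

section Bellman

open scoped ENNReal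

/-- Half of the distance `|p - q|`. Subtraction in `ℝ≥0∞` is truncated, so one of the two summands
vanishes; the value for `p = q = ∞` is `0`. -/
noncomputable def halfDiff (p q : ℝ≥0∞) : ℝ≥0∞ := ((p - q) + (q - p)) / 2

theorem halfDiff_ofReal {p q : ℝ} (hp : 0 ≤ p) (hq : 0 ≤ q) :
    halfDiff (ENNReal.ofReal p) (ENNReal.ofReal q) = ENNReal.ofReal (|p - q| / 2) := by
  unfold halfDiff
  rw [← ENNReal.ofReal_sub _ hq, ← ENNReal.ofReal_sub _ hp, ENNReal.ofReal_div_of_pos two_pos]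
  congr 1
  · rcases le_total p q with h | h
    · rw [ENNReal.ofReal_of_nonpos (by linarith), zero_add, abs_of_nonpos (by linarith), neg_sub]
    · rw [ENNReal.ofReal_of_nonpos (p := q - p) (by linarith), add_zero,
        abs_of_nonneg (by linarith)]
  · simp

/-- Quantitative midpoint convexity of the power function, for the points `p + q` and `p - q`. -/
theorem add_sq_mul_pow_le_pow_add_pow {p q : ℝ} (hq : |q| ≤ p) (k : ℕ) :
    2 * (p ^ (k + 2) + q ^ 2 * p ^ k) ≤ (p + q) ^ (k + 2) + (p - q) ^ (k + 2) := by
  have hp : 0 ≤ p := (abs_nonneg q).trans hq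
  have hq' := abs_le.1 hq
  have key : ∀ m : ℕ, 0 ≤ q * ((p + q) ^ m - (p - q) ^ m) := by
    intro m
    rcases le_total 0 q with h | h
    · exact mul_nonneg h (sub_nonneg.2 (pow_le_pow_left₀ (by linarith) (by linarith) m))
    · exact mul_nonneg_of_nonpos_of_nonpos h
        (sub_nonpos.2 (pow_le_pow_left₀ (by linarith) (by linarith) m))
  induction k with
  | zero => exact le_of_eq (by ring)
  | succ k ih =>
    have h1 := mul_le_mul_of_nonneg_left ih hp
    have h2 := key (k + 2)
    calc _ = p * (2 * (p ^ (k + 2) + q ^ 2 * p ^ k)) := by ring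
      _ ≤ p * ((p + q) ^ (k + 2) + (p - q) ^ (k + 2))
          + q * ((p + q) ^ (k + 2) - (p - q) ^ (k + 2)) := by linarith
      _ = _ := by ring

variable {α : Type*} [DecidableEq α]

/-- A family of strictly positive linear forms on `ℝ^α` that spans the dual space: the sum of the
coordinates, and that sum plus any one coordinate. -/
def bellmanWeight : Option α → α → ℝ≥0∞
  | none, _ => 1
  | some a, u => if u = a then 2 else 1

theorem one_le_bellmanWeight (o : Option α) (u : α) : 1 ≤ bellmanWeight o u := by
  cases o with
  | none => simp [bellmanWeight]
  | some a => unfold bellmanWeight; dsimp only; split_ifs <;> norm_num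

theorem bellmanWeight_ne_top (o : Option α) (u : α) : bellmanWeight o u ≠ ∞ := by
  cases o with
  | none => simp [bellmanWeight]
  | some a => unfold bellmanWeight; dsimp only; split_ifs <;> norm_num

variable [Fintype α]

/-- The homogeneous polynomial `∑ o, (λ o · g) ^ |α|`, where `λ o` are the linear forms
`bellmanWeight`. It has nonnegative coefficients and, for `2 ≤ |α|`, its Hessian on the positive
orthant dominates `(∑ u, g u) ^ (|α| - 2)` times the identity. -/
noncomputable def bellmanPoly (g : α → ℝ≥0∞) : ℝ≥0∞ :=
  ∑ o : Option α, (∑ u, bellmanWeight o u * g u) ^ Fintype.card α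

theorem two_mul_midpoint_pow_le (x y : ℝ≥0∞) (N : ℕ) :
    2 * ((x + y) / 2) ^ N ≤ x ^ N + y ^ N := by
  by_cases hN : N = 0
  · subst hN; norm_num
  by_cases hx : x = ∞
  · simp [hx, hN]
  by_cases hy : y = ∞
  · simp [hy, hN]
  lift x to NNReal using hx
  lift y to NNReal using hy
  have h : (2 : NNReal) * ((x + y) / 2) ^ N ≤ x ^ N + y ^ N := by
    rw [← NNReal.coe_le_coe]
    push_cast
    obtain _ | _ | k := N
    · simp at hN
    · simp; linarith
    · have := add_sq_mul_pow_le_pow_add_pow (p := ((x : ℝ) + y) / 2) (q := ((x : ℝ) - y) / 2)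
        (by rw [abs_le]; constructor <;> linarith [x.2, y.2, x.coe_nonneg, y.coe_nonneg]) k
      rw [show ((x : ℝ) + y) / 2 + (x - y) / 2 = x by ring,
        show ((x : ℝ) + y) / 2 - (x - y) / 2 = y by ring] at this
      have h0 : 0 ≤ (((x : ℝ) - y) / 2) ^ 2 * (((x : ℝ) + y) / 2) ^ k := by positivity
      linarith
  have h' := ENNReal.coe_le_coe.2 h
  rw [ENNReal.coe_mul, ENNReal.coe_pow, ENNReal.coe_div (by norm_num), ENNReal.coe_add,
    ENNReal.coe_add, ENNReal.coe_pow, ENNReal.coe_pow] at h'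
  exact h'

theorem bellmanPoly_midpoint_le (g h : α → ℝ≥0∞) :
    2 * bellmanPoly (fun u => (g u + h u) / 2) ≤ bellmanPoly g + bellmanPoly h := by
  unfold bellmanPoly
  rw [Finset.mul_sum, ← Finset.sum_add_distrib]
  refine Finset.sum_le_sum fun o _ => ?_
  refine le_trans (le_of_eq ?_) (two_mul_midpoint_pow_le _ _ _)
  congr 2
  rw [← Finset.sum_add_distrib, ENNReal.div_eq_inv_mul, Finset.mul_sum]
  refine Finset.sum_congr rfl fun u _ => ?_
  change bellmanWeight o u * ((g u + h u) / 2) = _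
  rw [← mul_add, ENNReal.div_eq_inv_mul]
  ring

theorem sum_pow_le_bellmanPoly (g : α → ℝ≥0∞) :
    (∑ u, g u) ^ Fintype.card α ≤ bellmanPoly g := by
  unfold bellmanPoly
  refine le_trans (le_of_eq ?_)
    (Finset.single_le_sum (fun o _ => zero_le) (Finset.mem_univ (none : Option α)))
  simp [bellmanWeight]

theorem bellmanPoly_eq_top {g : α → ℝ≥0∞} {u : α} (hu : g u = ∞) : bellmanPoly g = ∞ := by
  have hc : Fintype.card α ≠ 0 := (Fintype.card_pos_iff.2 ⟨u⟩).ne'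
  refine top_le_iff.1 (le_trans ?_ (sum_pow_le_bellmanPoly g))
  have : ∑ v, g v = ∞ := ENNReal.sum_eq_top.2 ⟨u, Finset.mem_univ u, hu⟩
  simp [this, hc]

/-- Quantitative convexity of `bellmanPoly`: the defect of midpoint convexity controls the square of
the increment of any single coordinate. -/
theorem bellmanPoly_midpoint_add_le (hα : 2 ≤ Fintype.card α) (g h : α → ℝ≥0∞) (u : α) :
    2 * bellmanPoly (fun v => (g v + h v) / 2)
      + halfDiff (g u) (h u) ^ 2 * (∑ v, (g v + h v) / 2) ^ (Fintype.card α - 2)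
      ≤ bellmanPoly g + bellmanPoly h := by
  -- If a coordinate is infinite, so is the right-hand side; otherwise all values are real.
  by_cases hg : ∃ v, g v = ∞
  · obtain ⟨v, hv⟩ := hg
    simp [bellmanPoly_eq_top hv]
  by_cases hh : ∃ v, h v = ∞
  · obtain ⟨v, hv⟩ := hh
    simp [bellmanPoly_eq_top hv]
  push Not at hg hh
  obtain ⟨k, hk⟩ := Nat.exists_eq_add_of_le' hα
  set g' : α → ℝ := fun v => (g v).toReal
  set h' : α → ℝ := fun v => (h v).toReal
  have hg0 : ∀ v, 0 ≤ g' v := fun v => ENNReal.toReal_nonneg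
  have hh0 : ∀ v, 0 ≤ h' v := fun v => ENNReal.toReal_nonneg
  set L : Option α → α → ℝ := fun o v => (bellmanWeight o v).toReal
  have hL1 : ∀ o v, 1 ≤ L o v := fun o v => by
    have := ENNReal.toReal_mono (bellmanWeight_ne_top o v) (one_le_bellmanWeight o v)
    simpa using this
  have hL0 : ∀ o v, 0 ≤ L o v := fun o v => zero_le_one.trans (hL1 o v)
  have hgr : ∀ v, g v = ENNReal.ofReal (g' v) := fun v => (ENNReal.ofReal_toReal (hg v)).symm
  have hhr : ∀ v, h v = ENNReal.ofReal (h' v) := fun v => (ENNReal.ofReal_toReal (hh v)).symm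
  have hLr : ∀ o v, bellmanWeight o v = ENNReal.ofReal (L o v) := fun o v =>
    (ENNReal.ofReal_toReal (bellmanWeight_ne_top o v)).symm
  have hmid : ∀ v, (g v + h v) / 2 = ENNReal.ofReal ((g' v + h' v) / 2) := fun v => by
    rw [hgr, hhr, ← ENNReal.ofReal_add (hg0 v) (hh0 v), ENNReal.ofReal_div_of_pos two_pos]
    simp
  have hpoly : ∀ (f : α → ℝ≥0∞) (f' : α → ℝ), (∀ v, 0 ≤ f' v) →
      (∀ v, f v = ENNReal.ofReal (f' v)) →
      bellmanPoly f = ENNReal.ofReal (∑ o, (∑ v, L o v * f' v) ^ (k + 2)) := by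
    intro f f' h0 hf
    unfold bellmanPoly
    rw [hk, ENNReal.ofReal_sum_of_nonneg fun o _ =>
      pow_nonneg (Finset.sum_nonneg fun v _ => mul_nonneg (hL0 o v) (h0 v)) _]
    refine Finset.sum_congr rfl fun o _ => ?_
    rw [ENNReal.ofReal_pow (Finset.sum_nonneg fun v _ => mul_nonneg (hL0 o v) (h0 v)),
      ENNReal.ofReal_sum_of_nonneg fun v _ => mul_nonneg (hL0 o v) (h0 v)]
    congr 1
    refine Finset.sum_congr rfl fun v _ => ?_
    rw [hLr, hf, ENNReal.ofReal_mul (hL0 o v)]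
  have hm0 : ∀ v, 0 ≤ (g' v + h' v) / 2 := fun v => by linarith [hg0 v, hh0 v]
  rw [hpoly _ g' hg0 hgr, hpoly _ h' hh0 hhr, hpoly _ _ hm0 hmid, hgr u, hhr u,
    halfDiff_ofReal (hg0 u) (hh0 u), Finset.sum_congr rfl fun v _ => hmid v,
    ← ENNReal.ofReal_sum_of_nonneg fun v _ => hm0 v, hk, Nat.add_sub_cancel,
    ← ENNReal.ofReal_pow (by positivity), ← ENNReal.ofReal_pow (Finset.sum_nonneg fun v _ => hm0 v),
    ← ENNReal.ofReal_mul (by positivity), ← ENNReal.ofReal_ofNat 2,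
    ← ENNReal.ofReal_mul (by norm_num)]
  have hs0 : 0 ≤ ∑ v, (g' v + h' v) / 2 := Finset.sum_nonneg fun v _ => hm0 v
  have hG : ∀ o, 0 ≤ ∑ v, L o v * g' v := fun o =>
    Finset.sum_nonneg fun v _ => mul_nonneg (hL0 o v) (hg0 v)
  have hH : ∀ o, 0 ≤ ∑ v, L o v * h' v := fun o =>
    Finset.sum_nonneg fun v _ => mul_nonneg (hL0 o v) (hh0 v)
  have hM : ∀ o, 0 ≤ ∑ v, L o v * ((g' v + h' v) / 2) := fun o =>
    Finset.sum_nonneg fun v _ => mul_nonneg (hL0 o v) (hm0 v)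
  rw [← ENNReal.ofReal_add (by have := fun o => pow_nonneg (hM o) (k + 2); positivity)
    (by positivity), ← ENNReal.ofReal_add (Finset.sum_nonneg fun o _ => pow_nonneg (hG o) _)
    (Finset.sum_nonneg fun o _ => pow_nonneg (hH o) _)]
  refine ENNReal.ofReal_le_ofReal ?_
  set s := ∑ v, (g' v + h' v) / 2
  set q : Option α → ℝ := fun o => ∑ v, L o v * ((g' v - h' v) / 2)
  set p : Option α → ℝ := fun o => ∑ v, L o v * ((g' v + h' v) / 2)
  have hpq : ∀ o, p o + q o = ∑ v, L o v * g' v := fun o => by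
    simp only [p, q, ← Finset.sum_add_distrib]
    exact Finset.sum_congr rfl fun v _ => by ring
  have hpq' : ∀ o, p o - q o = ∑ v, L o v * h' v := fun o => by
    simp only [p, q, ← Finset.sum_sub_distrib]
    exact Finset.sum_congr rfl fun v _ => by ring
  have hsp : ∀ o, s ≤ p o := fun o => Finset.sum_le_sum fun v _ => by
    have := mul_le_mul_of_nonneg_right (hL1 o v) (hm0 v)
    linarith
  -- Convexity along each linear form; the weights are at least one, so `s ≤ p o`.
  have hstep : ∀ o, 2 * (p o ^ (k + 2) + q o ^ 2 * s ^ k)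
      ≤ (∑ v, L o v * g' v) ^ (k + 2) + (∑ v, L o v * h' v) ^ (k + 2) := fun o => by
    rw [← hpq, ← hpq']
    refine le_trans ?_ (add_sq_mul_pow_le_pow_add_pow (abs_le.2 ⟨?_, ?_⟩) k)
    · have := mul_le_mul_of_nonneg_left (pow_le_pow_left₀ hs0 (hsp o) k) (sq_nonneg (q o))
      linarith
    · linarith [hpq o, hG o]
    · linarith [hpq' o, hH o]
  -- The increment of the coordinate `u` is the difference of the two forms `some u` and `none`.
  have hu : q (some u) - q none = (g' u - h' u) / 2 := by
    simp only [q, ← Finset.sum_sub_distrib, ← sub_mul]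
    rw [Finset.sum_eq_single u]
    · simp only [L, bellmanWeight, if_true]; norm_num
    · intro v _ hv
      simp [L, bellmanWeight, hv]
    · simp
  have hq2 : (|g' u - h' u| / 2) ^ 2 ≤ 2 * ∑ o, q o ^ 2 := by
    have h1 : q none ^ 2 + q (some u) ^ 2 ≤ ∑ o, q o ^ 2 := by
      rw [Fintype.sum_option]
      gcongr
      exact Finset.single_le_sum (f := fun v => q (some v) ^ 2) (fun v _ => sq_nonneg _)
        (Finset.mem_univ u)
    have h2 : (|g' u - h' u| / 2) ^ 2 = (q (some u) - q none) ^ 2 := by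
      rw [hu, div_pow, div_pow, sq_abs]
    rw [h2]
    nlinarith [sq_nonneg (q (some u) + q none)]
  calc _ ≤ 2 * ∑ o, p o ^ (k + 2) + (2 * ∑ o, q o ^ 2) * s ^ k := by gcongr
    _ = ∑ o, 2 * (p o ^ (k + 2) + q o ^ 2 * s ^ k) := by
      rw [← Finset.mul_sum, Finset.sum_add_distrib, ← Finset.sum_mul]; ring
    _ ≤ _ := by
      rw [← Finset.sum_add_distrib]
      exact Finset.sum_le_sum fun o _ => hstep o

/-- The weight of the monomial `∏ v, g (t v)` in the expansion of `bellmanPoly`. -/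
noncomputable def monomialWeight (t : α → α) : ℝ≥0∞ :=
  ∑ o : Option α, ∏ v, bellmanWeight o (t v)

theorem bellmanPoly_eq_sum (g : α → ℝ≥0∞) :
    bellmanPoly g = ∑ t : α → α, monomialWeight t * ∏ v, g (t v) := by
  unfold bellmanPoly monomialWeight
  simp_rw [Finset.sum_mul]
  rw [Finset.sum_comm]
  refine Finset.sum_congr rfl fun o _ => ?_
  rw [← Finset.card_univ, ← Finset.prod_const, Finset.prod_univ_sum, Fintype.piFinset_univ]
  exact Finset.sum_congr rfl fun t _ => Finset.prod_mul_distrib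

theorem one_le_monomialWeight (t : α → α) : 1 ≤ monomialWeight t := by
  unfold monomialWeight
  refine le_trans (le_of_eq ?_)
    (Finset.single_le_sum (fun o _ => zero_le) (Finset.mem_univ (none : Option α)))
  simp [bellmanWeight]

theorem monomialWeight_ne_top (t : α → α) : monomialWeight t ≠ ∞ :=
  ENNReal.sum_ne_top.2 fun _ _ => ENNReal.prod_ne_top fun _ _ => bellmanWeight_ne_top _ _

end Bellman

/-! ### The Bellman function of a complete hypergraph -/

section CompleteHypergraph

open scoped ENNReal

variable {r : ℕ} {W : Fin r → Type}

section Relabel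

variable [∀ j, Fintype (W j)] {M : Type*} [CommMonoid M]

/-- The product over all edges through the vertex `u` of the part `i` of the functions attached to
the edges, as a function of the variable `t` of `u` and of the variables `x` of the other parts. -/
def fiberProd (F : (∀ j, W j) → (Fin r → ℝ) → M) (i : Fin r) (x : ∀ j, W j → ℝ) (u : W i)
    (t : ℝ) : M :=
  ∏ e : ∀ j : {j // j ≠ i}, W j, F ((Equiv.piSplitAt i W).symm (u, e))
    fun j => Function.update x i (fun _ => t) j ((Equiv.piSplitAt i W).symm (u, e) j)

/-- When the variables of the part `i` are `z` and its vertices are relabelled by `t`, the product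
of all the functions is a product of functions of the single variables `z v`. -/
theorem prod_update_eq_prod_fiberProd (F : (∀ j, W j) → (Fin r → ℝ) → M) (i : Fin r)
    (x : ∀ j, W j → ℝ) (z : W i → ℝ) (t : W i → W i) :
    ∏ e, F (Function.update e i (t (e i))) (fun j => Function.update x i z j (e j))
      = ∏ v, fiberProd F i x (t v) (z v) := by
  rw [← (Equiv.piSplitAt i W).symm.prod_comp, Fintype.prod_prod_type]
  refine Finset.prod_congr rfl fun v _ => Finset.prod_congr rfl fun e _ => ?_
  congr 1
  · ext j
    by_cases hj : j = i
    · subst hj; simp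
    · simp [hj]
  · ext j
    by_cases hj : j = i
    · subst hj; simp
    · simp [hj]

theorem prod_eq_prod_fiberProd (F : (∀ j, W j) → (Fin r → ℝ) → M) (i : Fin r)
    (x : ∀ j, W j → ℝ) (z : W i → ℝ) :
    ∏ e, F e (fun j => Function.update x i z j (e j)) = ∏ v, fiberProd F i x v (z v) := by
  simpa using prod_update_eq_prod_fiberProd F i x z id

theorem measurable_fiberProd [MeasurableSpace M] [MeasurableMul₂ M]
    {F : (∀ j, W j) → (Fin r → ℝ) → M} (hF : ∀ e, Measurable (F e)) (i : Fin r) (u : W i) :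
    Measurable fun p : (∀ j, W j → ℝ) × ℝ => fiberProd F i p.1 u p.2 := by
  unfold fiberProd
  refine Finset.measurable_prod _ fun e _ => (hF _).comp ?_
  refine measurable_pi_iff.2 fun j => ?_
  by_cases hj : j = i
  · subst hj; simpa using measurable_snd
  · simp only [Function.update_of_ne hj]; fun_prop

end Relabel

section Law

variable (W) [∀ j, Fintype (W j)]

/-- The law of independent real variables `x j v`, one for each vertex, where the variables of the
`j`-th part have law `μ j`. -/
noncomputable def vertexLaw (μ : Fin r → Measure ℝ) : Measure (∀ j, W j → ℝ) :=
  Measure.pi fun j => Measure.pi fun _ : W j => μ j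

instance (μ : Fin r → Measure ℝ) [∀ j, IsProbabilityMeasure (μ j)] :
    IsProbabilityMeasure (vertexLaw W μ) := by
  unfold vertexLaw; infer_instance

theorem measurePreserving_vertexLaw_update (μ : Fin r → Measure ℝ)
    [∀ j, IsProbabilityMeasure (μ j)] (i : Fin r) (ρ : Measure ℝ) [IsProbabilityMeasure ρ] :
    MeasurePreserving (fun p : (∀ j, W j → ℝ) × (W i → ℝ) => Function.update p.1 i p.2)
      ((vertexLaw W μ).prod (Measure.pi fun _ => ρ)) (vertexLaw W (Function.update μ i ρ)) := by
  have h := measurePreserving_update (fun j => Measure.pi fun _ : W j => μ j) i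
    (Measure.pi fun _ => ρ)
  have e : (fun j => Measure.pi fun _ : W j => Function.update μ i ρ j)
      = Function.update (fun j => Measure.pi fun _ : W j => μ j) i (Measure.pi fun _ => ρ) := by
    ext1 j
    by_cases hj : j = i
    · subst hj; simp
    · simp [hj]
  unfold vertexLaw
  rwa [e]

end Law

variable [∀ j, Fintype (W j)]

/-- The form attached to the complete `r`-partite hypergraph with parts `W j`: the expectation of
the product of all the functions, when the variables of the vertices are independent. -/
noncomputable def completeForm (F : (∀ j, W j) → (Fin r → ℝ) → ℝ≥0∞) (μ : Fin r → Measure ℝ) :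
    ℝ≥0∞ :=
  ∫⁻ x, ∏ e, F e (fun j => x j (e j)) ∂vertexLaw W μ

/-- The expectation of `fiberProd` over the variable of the vertex `u`. -/
noncomputable def fiberMean (F : (∀ j, W j) → (Fin r → ℝ) → ℝ≥0∞) (i : Fin r) (ρ : Measure ℝ)
    (x : ∀ j, W j → ℝ) (u : W i) : ℝ≥0∞ :=
  ∫⁻ t, fiberProd F i x u t ∂ρ

theorem measurable_fiberMean {F : (∀ j, W j) → (Fin r → ℝ) → ℝ≥0∞} (hF : ∀ e, Measurable (F e))
    (i : Fin r) (ρ : Measure ℝ) [IsProbabilityMeasure ρ] (u : W i) :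
    Measurable fun x => fiberMean F i ρ x u :=
  (measurable_fiberProd hF i u).lintegral_prod_right'

theorem fiberMean_split {F : (∀ j, W j) → (Fin r → ℝ) → ℝ≥0∞} {μ : Fin r → Measure ℝ} {i : Fin r}
    {ρ : Fin 2 → Measure ℝ} (h : μ i = (2 : ℝ≥0∞)⁻¹ • (ρ 0 + ρ 1)) (x : ∀ j, W j → ℝ) (u : W i) :
    fiberMean F i (μ i) x u = (fiberMean F i (ρ 0) x u + fiberMean F i (ρ 1) x u) / 2 := by
  unfold fiberMean
  rw [h, lintegral_smul_measure, lintegral_add_measure, ENNReal.div_eq_inv_mul, smul_eq_mul]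

/-- For fixed variables of the other parts, the variables of the part `i` are independent. -/
theorem completeForm_update {F : (∀ j, W j) → (Fin r → ℝ) → ℝ≥0∞} (hF : ∀ e, Measurable (F e))
    (μ : Fin r → Measure ℝ) [∀ j, IsProbabilityMeasure (μ j)] (i : Fin r) (ρ : Measure ℝ)
    [IsProbabilityMeasure ρ] (t : W i → W i) :
    completeForm (fun e => F (Function.update e i (t (e i)))) (Function.update μ i ρ)
      = ∫⁻ x, ∏ v, fiberMean F i ρ x (t v) ∂vertexLaw W μ := by
  have hm : Measurable fun x : ∀ j, W j → ℝ =>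
      ∏ e, F (Function.update e i (t (e i))) (fun j => x j (e j)) :=
    Finset.measurable_prod _ fun e _ => (hF _).comp (by fun_prop)
  have hp := measurePreserving_vertexLaw_update W μ i ρ
  unfold completeForm
  rw [← hp.lintegral_comp hm]
  refine (lintegral_prod _ (hm.comp hp.measurable).aemeasurable).trans ?_
  refine lintegral_congr fun x => ?_
  simp only [Function.comp_def, prod_update_eq_prod_fiberProd]
  exact lintegral_pi_prod (fun _ => ρ) (fun v => fiberProd F i x (t v)) fun v =>
    (measurable_fiberProd hF i (t v)).comp (measurable_prodMk_left (x := x))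

variable [∀ j, DecidableEq (W j)]

/-- The weighted sum of the forms over all relabellings of one part is the integral of a
`bellmanPoly`. -/
theorem sum_monomialWeight_mul_completeForm {F : (∀ j, W j) → (Fin r → ℝ) → ℝ≥0∞}
    (hF : ∀ e, Measurable (F e)) (μ : Fin r → Measure ℝ) [∀ j, IsProbabilityMeasure (μ j)]
    (i : Fin r) (ρ : Measure ℝ) [IsProbabilityMeasure ρ] :
    ∑ t : W i → W i, monomialWeight t *
        completeForm (fun e => F (Function.update e i (t (e i)))) (Function.update μ i ρ)
      = ∫⁻ x, bellmanPoly (fiberMean F i ρ x) ∂vertexLaw W μ := by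
  have hm : ∀ t : W i → W i, Measurable fun x => ∏ v, fiberMean F i ρ x (t v) := fun t =>
    Finset.measurable_prod _ fun v _ => measurable_fiberMean hF i ρ (t v)
  simp only [completeForm_update hF, bellmanPoly_eq_sum]
  rw [lintegral_finsetSum _ fun t _ => (hm t).const_mul _]
  exact Finset.sum_congr rfl fun t _ => (lintegral_const_mul _ (hm t)).symm

/-- The Bellman function of the family `F`: a positive combination of the forms obtained from `F` by
relabelling the vertices of each part, whose weights turn it, as a function of the variables of any
one part, into the integral of a `bellmanPoly`. -/
noncomputable def bellmanForm (F : (∀ j, W j) → (Fin r → ℝ) → ℝ≥0∞) (μ : Fin r → Measure ℝ) :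
    ℝ≥0∞ :=
  ∑ τ : ∀ j, W j → W j, (∏ j, monomialWeight (τ j)) *
    completeForm (fun e => F fun j => τ j (e j)) μ

/-- The Bellman function as a function of the law of the variables of one part. The relabelling of
this part is absorbed into `bellmanPoly`, the relabellings `τ` of the other parts remain. -/
theorem bellmanForm_update {F : (∀ j, W j) → (Fin r → ℝ) → ℝ≥0∞} (hF : ∀ e, Measurable (F e))
    (μ : Fin r → Measure ℝ) [∀ j, IsProbabilityMeasure (μ j)] (i : Fin r) (ρ : Measure ℝ)
    [IsProbabilityMeasure ρ] :
    bellmanForm F (Function.update μ i ρ) =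
      ∑ τ : ∀ j : {j // j ≠ i}, W j → W j, (∏ j, monomialWeight (τ j)) *
        ∫⁻ x, bellmanPoly (fiberMean (fun e => F fun j =>
          (Equiv.piSplitAt i fun j => W j → W j).symm (id, τ) j (e j)) i ρ x) ∂vertexLaw W μ := by
  unfold bellmanForm
  rw [← (Equiv.piSplitAt i fun j => W j → W j).symm.sum_comp, Fintype.sum_prod_type,
    Finset.sum_comm]
  refine Finset.sum_congr rfl fun τ _ => ?_
  rw [← sum_monomialWeight_mul_completeForm (fun e => hF _), Finset.mul_sum]
  refine Finset.sum_congr rfl fun t _ => ?_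
  rw [← mul_assoc]
  congr 1
  · rw [Fintype.prod_eq_mul_prod_subtype_ne _ i, mul_comm]
    congr 1
    · refine Finset.prod_congr rfl fun j _ => ?_
      simp [j.2]
    · simp
  · congr 1
    ext1 e
    congr 1
    ext1 j
    by_cases hj : j = i
    · subst hj; simp
    · simp [hj]

/-- The amount by which the Bellman function grows when the law of the variables of the part `i` is
split into the halves `ρ 0` and `ρ 1`, as witnessed by the vertex `u`. -/
noncomputable def bellmanGain (F : (∀ j, W j) → (Fin r → ℝ) → ℝ≥0∞) (μ : Fin r → Measure ℝ)
    (i : Fin r) (ρ : Fin 2 → Measure ℝ) (u : W i) : ℝ≥0∞ :=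
  ∫⁻ x, halfDiff (fiberMean F i (ρ 0) x u) (fiberMean F i (ρ 1) x u) ^ 2
    * (∑ v, fiberMean F i (μ i) x v) ^ (Fintype.card (W i) - 2) ∂vertexLaw W μ

omit [∀ j, Fintype (W j)] [∀ j, DecidableEq (W j)] in
theorem piSplitAt_symm_id (i : Fin r) :
    (Equiv.piSplitAt i fun j => W j → W j).symm (id, fun _ => id) = fun _ => id := by
  ext j w
  by_cases hj : j = i
  · subst hj; simp
  · simp [hj]

variable {F : (∀ j, W j) → (Fin r → ℝ) → ℝ≥0∞} {μ : Fin r → Measure ℝ}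
  [∀ j, IsProbabilityMeasure (μ j)] {i : Fin r} {ρ : Fin 2 → Measure ℝ}
  [∀ b, IsProbabilityMeasure (ρ b)]

theorem measurable_bellmanPoly_fiberMean (hF : ∀ e, Measurable (F e)) (i : Fin r)
    (ν : Measure ℝ) [IsProbabilityMeasure ν] :
    Measurable fun x => bellmanPoly (fiberMean F i ν x) := by
  unfold bellmanPoly
  have := fun u => measurable_fiberMean hF i ν u
  fun_prop

/-- Splitting the law of one part does not decrease the average of the Bellman function. -/
theorem two_mul_bellmanForm_le (hF : ∀ e, Measurable (F e))
    (h : μ i = (2 : ℝ≥0∞)⁻¹ • (ρ 0 + ρ 1)) :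
    2 * bellmanForm F μ
      ≤ bellmanForm F (Function.update μ i (ρ 0)) + bellmanForm F (Function.update μ i (ρ 1)) := by
  conv_lhs => rw [← Function.update_eq_self i μ]
  rw [bellmanForm_update hF, bellmanForm_update hF, bellmanForm_update hF,
    ← Finset.sum_add_distrib, Finset.mul_sum]
  refine Finset.sum_le_sum fun τ _ => ?_
  rw [mul_left_comm, ← mul_add, ← lintegral_add_left
    (measurable_bellmanPoly_fiberMean (fun e => hF _) i _), ← lintegral_const_mul _
    (measurable_bellmanPoly_fiberMean (fun e => hF _) i _)]
  gcongr with x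
  simp only [funext (fiberMean_split h x)]
  exact bellmanPoly_midpoint_le _ _

/-- Splitting the law of one part makes the average of the Bellman function grow by at least half
of the gain of any of its vertices. -/
theorem two_mul_bellmanForm_add_gain_le (hF : ∀ e, Measurable (F e))
    (h : μ i = (2 : ℝ≥0∞)⁻¹ • (ρ 0 + ρ 1)) (hW : 2 ≤ Fintype.card (W i)) (u : W i) :
    2 * bellmanForm F μ + bellmanGain F μ i ρ u
      ≤ bellmanForm F (Function.update μ i (ρ 0)) + bellmanForm F (Function.update μ i (ρ 1)) := by
  conv_lhs => rw [← Function.update_eq_self i μ]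
  rw [bellmanForm_update hF, bellmanForm_update hF, bellmanForm_update hF,
    ← Finset.sum_add_distrib, Finset.mul_sum, Function.update_eq_self]
  -- The gain is paid by the summand in which the other parts are not relabelled.
  set τ₀ : ∀ j : {j // j ≠ i}, W j → W j := fun j => id
  rw [← Finset.sum_erase_add _ _ (Finset.mem_univ τ₀),
    ← Finset.sum_erase_add _ _ (Finset.mem_univ τ₀), add_assoc]
  refine add_le_add (Finset.sum_le_sum fun τ _ => ?_) ?_
  · rw [mul_left_comm, ← mul_add, ← lintegral_add_left
      (measurable_bellmanPoly_fiberMean (fun e => hF _) i _), ← lintegral_const_mul _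
      (measurable_bellmanPoly_fiberMean (fun e => hF _) i _)]
    gcongr with x
    simp only [funext (fiberMean_split h x)]
    exact bellmanPoly_midpoint_le _ _
  · simp only [show (Equiv.piSplitAt i fun j => W j → W j).symm (id, τ₀) = fun j => id from
      piSplitAt_symm_id i, id]
    have hw : 1 ≤ ∏ j, monomialWeight (τ₀ j) :=
      Finset.one_le_prod' fun j _ => one_le_monomialWeight _
    calc _ ≤ 2 * ((∏ j, monomialWeight (τ₀ j)) *
            ∫⁻ x, bellmanPoly (fiberMean F i (μ i) x) ∂vertexLaw W μ)
          + (∏ j, monomialWeight (τ₀ j)) * bellmanGain F μ i ρ u := by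
          gcongr
          exact le_mul_of_one_le_left zero_le hw
      _ ≤ _ := by
        rw [mul_left_comm, ← mul_add, ← mul_add]
        refine mul_le_mul_of_nonneg_left ?_ zero_le
        unfold bellmanGain
        rw [← lintegral_add_left (measurable_bellmanPoly_fiberMean hF i _),
          ← lintegral_const_mul _ (measurable_bellmanPoly_fiberMean hF i _),
          ← lintegral_add_left ((measurable_bellmanPoly_fiberMean hF i _).const_mul _)]
        refine lintegral_mono fun x => ?_
        simp only [funext (fiberMean_split h x)]
        exact bellmanPoly_midpoint_add_le hW _ _ u

end CompleteHypergraph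

/-! ### Splitting the laws of all parts -/

section Children

open scoped ENNReal

/-- The probability measures `ρ 0` and `ρ 1` are the two halves of the probability measure `μ`, and
`σ` is the difference of the densities of `ρ 0` and `ρ 1`, divided by two. -/
structure IsSplit (μ : Measure ℝ) (ρ : Fin 2 → Measure ℝ) (σ : ℝ → ℝ) : Prop where
  prob : IsProbabilityMeasure μ
  prob_half : ∀ b, IsProbabilityMeasure (ρ b)
  measurable : Measurable σ
  abs_sign : ∀ t, |σ t| = 1
  half_eq : ∀ b, ρ b = μ.withDensity fun t => ENNReal.ofReal (1 + (-1) ^ (b : ℕ) * σ t)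

theorem IsSplit.eq_mean {μ : Measure ℝ} {ρ : Fin 2 → Measure ℝ} {σ : ℝ → ℝ} (h : IsSplit μ ρ σ) :
    μ = (2 : ℝ≥0∞)⁻¹ • (ρ 0 + ρ 1) := by
  have hσ := h.measurable
  rw [h.half_eq, h.half_eq, ← withDensity_add_left (by fun_prop)]
  have : ((fun t => ENNReal.ofReal (1 + (-1) ^ ((0 : Fin 2) : ℕ) * σ t))
      + fun t => ENNReal.ofReal (1 + (-1) ^ ((1 : Fin 2) : ℕ) * σ t)) = fun _ => 2 := by
    ext t
    have := abs_le.1 (h.abs_sign t).le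
    simp only [Pi.add_apply]
    rw [← ENNReal.ofReal_add (by simp; linarith) (by simp; linarith)]
    simp only [Fin.val_zero, Fin.val_one, pow_zero, pow_one]
    rw [show 1 + 1 * σ t + (1 + -1 * σ t) = 2 by ring]
    simp
  rw [this, withDensity_const, smul_smul, ENNReal.inv_mul_cancel (by norm_num) (by norm_num),
    one_smul]

theorem sum_update_add_sum_update {r : ℕ} {M : Type*} [CommSemiring M] (i : Fin r)
    (f : (Fin r → Fin 2) → M) :
    ∑ b, (f (Function.update b i 0) + f (Function.update b i 1)) = 2 * ∑ b, f b := by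
  have hinv : Function.Involutive fun b : Fin r → Fin 2 => Function.update b i (b i + 1) := by
    intro b
    have : b i + 1 + 1 = b i := by generalize b i = c; fin_cases c <;> rfl
    simp [this]
  have h := Equiv.sum_comp hinv.toPerm f
  rw [two_mul]
  nth_rewrite 2 [← h]
  rw [← Finset.sum_add_distrib]
  refine Finset.sum_congr rfl fun b _ => ?_
  have hb : b i = 0 ∨ b i = 1 := by generalize b i = c; fin_cases c <;> simp
  have hs : Function.update b i (b i) = b := Function.update_eq_self i b
  change _ = f b + f (Function.update b i (b i + 1))
  rcases hb with hb | hb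
  · rw [hb] at hs ⊢; rw [hs, zero_add]
  · rw [hb] at hs ⊢; rw [hs, add_comm]; rfl

variable {r : ℕ} {W : Fin r → Type} [∀ j, Fintype (W j)] [∀ j, DecidableEq (W j)]
  {F : (∀ j, W j) → (Fin r → ℝ) → ℝ≥0∞} {μ : Fin r → Measure ℝ} {ρ : Fin r → Fin 2 → Measure ℝ}
  {σ : Fin r → ℝ → ℝ}

/-- The laws in which the parts in `s` are replaced by the halves selected by `b`. -/
noncomputable def partialSplit (μ : Fin r → Measure ℝ) (ρ : Fin r → Fin 2 → Measure ℝ)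
    (s : Finset (Fin r)) (b : Fin r → Fin 2) (j : Fin r) : Measure ℝ :=
  if j ∈ s then ρ j (b j) else μ j

theorem update_partialSplit {s : Finset (Fin r)} {i : Fin r} (b : Fin r → Fin 2)
    (c : Fin 2) : Function.update (partialSplit μ ρ s b) i (ρ i c)
      = partialSplit μ ρ (insert i s) (Function.update b i c) := by
  ext1 j
  by_cases hj : j = i
  · subst hj; simp [partialSplit]
  · simp [partialSplit, hj]

theorem isProbabilityMeasure_partialSplit (h : ∀ j, IsSplit (μ j) (ρ j) (σ j))
    (s : Finset (Fin r)) (b : Fin r → Fin 2) (j : Fin r) :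
    IsProbabilityMeasure (partialSplit μ ρ s b j) := by
  unfold partialSplit
  split_ifs
  exacts [(h j).prob_half _, (h j).prob]

/-- Splitting one more part does not decrease the Bellman function. Both sums run over all choices
of halves, although the choices outside `s` do not matter. -/
theorem sum_bellmanForm_le_insert (hF : ∀ e, Measurable (F e))
    (h : ∀ j, IsSplit (μ j) (ρ j) (σ j)) {s : Finset (Fin r)} {i : Fin r} (hi : i ∉ s) :
    ∑ b, bellmanForm F (partialSplit μ ρ s b)
      ≤ ∑ b, bellmanForm F (partialSplit μ ρ (insert i s) b) := by
  have := isProbabilityMeasure_partialSplit h s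
  have := (h i).prob_half
  rw [← ENNReal.mul_le_mul_iff_right two_ne_zero ENNReal.ofNat_ne_top,
    ← sum_update_add_sum_update i fun b => bellmanForm F (partialSplit μ ρ (insert i s) b),
    Finset.mul_sum]
  refine Finset.sum_le_sum fun b _ => ?_
  rw [← update_partialSplit, ← update_partialSplit]
  refine two_mul_bellmanForm_le hF ?_
  simpa [partialSplit, hi] using (h i).eq_mean

theorem sum_bellmanForm_le_univ (hF : ∀ e, Measurable (F e))
    (h : ∀ j, IsSplit (μ j) (ρ j) (σ j)) (s : Finset (Fin r)) :
    ∑ b, bellmanForm F (partialSplit μ ρ s b) ≤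
      ∑ b : Fin r → Fin 2, bellmanForm F (fun j => ρ j (b j)) := by
  have key : ∀ u : Finset (Fin r), Disjoint s u → ∑ b, bellmanForm F (partialSplit μ ρ s b)
      ≤ ∑ b, bellmanForm F (partialSplit μ ρ (s ∪ u) b) := by
    intro u
    induction u using Finset.induction_on with
    | empty => simp
    | insert i u hi ih =>
      intro hd
      rw [Finset.disjoint_insert_right] at hd
      rw [Finset.union_insert]
      exact (ih hd.2).trans (sum_bellmanForm_le_insert hF h (by simp [hd.1, hi]))
  refine (key _ disjoint_compl_right).trans (le_of_eq ?_)
  refine Finset.sum_congr rfl fun b _ => ?_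
  congr 1
  ext1 j
  simp [partialSplit]

/-- Splitting all parts makes the average of the Bellman function grow by at least the gain of any
single part `i`, since the part `i` may be split before the others. -/
theorem bellmanForm_add_gain_le_sum (hF : ∀ e, Measurable (F e))
    (h : ∀ j, IsSplit (μ j) (ρ j) (σ j)) {i : Fin r} (hW : 2 ≤ Fintype.card (W i)) (u : W i) :
    2 ^ r * (2 * bellmanForm F μ + bellmanGain F μ i (ρ i) u)
      ≤ 2 * ∑ b : Fin r → Fin 2, bellmanForm F (fun j => ρ j (b j)) := by
  have := fun j => (h j).prob
  have := (h i).prob_half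
  refine le_trans ?_ (mul_le_mul_of_nonneg_left (sum_bellmanForm_le_univ hF h {i}) zero_le)
  rw [← sum_update_add_sum_update i]
  calc _ = ∑ b : Fin r → Fin 2, (2 * bellmanForm F μ + bellmanGain F μ i (ρ i) u) := by
        rw [Finset.sum_const, nsmul_eq_mul]; simp
    _ ≤ _ := Finset.sum_le_sum fun b _ => ?_
  have e := fun c => update_partialSplit (μ := μ) (ρ := ρ) (s := ∅) (i := i) b c
  rw [insert_empty_eq] at e
  have e0 : partialSplit μ ρ ∅ b = μ := by ext1 j; simp [partialSplit]
  rw [← e, ← e, e0]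
  exact two_mul_bellmanForm_add_gain_le hF (h i).eq_mean hW u

end Children

section Matching

open scoped ENNReal

variable {r : ℕ} {W : Fin r → Type} [∀ j, Fintype (W j)]

variable (W) in
/-- The maximal degree of a vertex in the complete `r`-partite hypergraph with parts `W j`. -/
def maxDegree : ℕ :=
  Finset.univ.sup fun i : Fin r => ∏ j ∈ Finset.univ.erase i, Fintype.card (W j)

variable (W) in
/-- The edges of the complete `r`-partite hypergraph can be coloured with `maxDegree W` colours such
that the edges of each colour are disjoint: if `W i` is the smallest part, the colour of `e` is the
collection of the differences `e j - e i` modulo the sizes of the other parts. -/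
theorem exists_matching_coloring (i₀ : Fin r) :
    ∃ (κ : Type) (_ : Fintype κ) (c : (∀ j, W j) → κ), Fintype.card κ ≤ maxDegree W ∧
      ∀ e e', c e = c e' → ∀ j, e j = e' j → e = e' := by
  classical
  by_cases hne : ∀ j, Fintype.card (W j) ≠ 0
  swap
  · push Not at hne
    obtain ⟨j, hj⟩ := hne
    have : IsEmpty (W j) := Fintype.card_eq_zero_iff.1 hj
    exact ⟨Empty, inferInstance, fun e => isEmptyElim (e j), by simp, fun e => isEmptyElim (e j)⟩
  have := fun j => (⟨hne j⟩ : NeZero (Fintype.card (W j)))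
  obtain ⟨i, -, hi⟩ := Finset.exists_min_image Finset.univ (fun j => Fintype.card (W j))
    ⟨i₀, Finset.mem_univ _⟩
  let idx : ∀ j, W j → ℕ := fun j w => Fintype.equivFin (W j) w
  have hidx : ∀ j w, idx j w < Fintype.card (W j) := fun j w => (Fintype.equivFin (W j) w).2
  have hinj : ∀ j w w', idx j w = idx j w' → w = w' := fun j w w' h =>
    (Fintype.equivFin (W j)).injective (Fin.ext h)
  -- The index of a vertex of the smallest part can be recovered from its residue modulo any
  -- `Fintype.card (W j)`.
  have hcast : ∀ j (a b : ℕ), a < Fintype.card (W j) → b < Fintype.card (W j) →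
      (a : ZMod (Fintype.card (W j))) = b → a = b := fun j a b ha hb h => by
    rw [ZMod.natCast_eq_natCast_iff'] at h
    rwa [Nat.mod_eq_of_lt ha, Nat.mod_eq_of_lt hb] at h
  refine ⟨∀ j : {j // j ≠ i}, ZMod (Fintype.card (W j)), inferInstance,
    fun e j => (idx j (e j) : ZMod _) - (idx i (e i) : ZMod _), ?_, ?_⟩
  · rw [Fintype.card_pi]
    simp only [ZMod.card]
    refine le_trans (le_of_eq ?_) (Finset.le_sup (Finset.mem_univ i))
    rw [← Finset.prod_subtype (p := fun j => j ≠ i) (Finset.univ.erase i) (by simp)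
      fun j => Fintype.card (W j)]
  · intro e e' h j hj
    have hei : e i = e' i := by
      by_cases hji : j = i
      · subst hji; exact hj
      · have h1 := congrFun h ⟨j, hji⟩
        simp only [hj, sub_right_inj] at h1
        exact hinj i _ _ (hcast j _ _ ((hidx i _).trans_le (hi j (Finset.mem_univ j)))
          ((hidx i _).trans_le (hi j (Finset.mem_univ j))) h1)
    ext k
    by_cases hk : k = i
    · subst hk; exact hei
    · have h1 := congrFun h ⟨k, hk⟩
      simp only [hei, sub_left_inj] at h1
      exact hinj k _ _ (hcast k _ _ (hidx k _) (hidx k _) h1)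

/-- The functions of a matching depend on disjoint sets of variables, hence are independent. -/
theorem lintegral_matching (M : Finset (∀ j, W j))
    (hM : ∀ e ∈ M, ∀ e' ∈ M, ∀ j, e j = e' j → e = e')
    (f : (∀ j, W j) → (Fin r → ℝ) → ℝ≥0∞) (hf : ∀ e, Measurable (f e)) (μ : Fin r → Measure ℝ)
    [∀ j, IsProbabilityMeasure (μ j)] :
    ∫⁻ x, ∏ e ∈ M, f e (fun j => x j (e j)) ∂vertexLaw W μ
      = ∏ e ∈ M, ∫⁻ y, f e y ∂Measure.pi μ := by
  have h1 := measurePreserving_comp_sigma (fun v : Σ j, W j => μ v.1) (fun v => v)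
    Function.injective_id
  have h2 := measurePreserving_comp_sigma (κ := M) (α := fun _ => Fin r)
    (fun v : Σ j, W j => μ v.1) (fun p => ⟨p.2, p.1.1 p.2⟩) (by
      rintro ⟨e, j⟩ ⟨e', j'⟩ h
      simp only [Sigma.mk.injEq] at h
      obtain ⟨rfl, h⟩ := h
      have := hM e.1 e.2 e'.1 e'.2 j (eq_of_heq h)
      rw [Subtype.ext this])
  have hm : Measurable fun x : ∀ j, W j → ℝ => ∏ e ∈ M, f e (fun j => x j (e j)) :=
    Finset.measurable_prod _ fun e _ => (hf _).comp (by fun_prop)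
  have hm2 : Measurable fun y : M → Fin r → ℝ => ∏ e, f e.1 (y e) :=
    Finset.measurable_prod _ fun e _ => (hf _).comp (by fun_prop)
  unfold vertexLaw
  rw [← h1.lintegral_comp hm, ← Finset.prod_coe_sort M, ← lintegral_pi_prod _ _ fun e : M => hf e,
    ← h2.lintegral_comp hm2]
  refine lintegral_congr fun x => ?_
  exact (Finset.prod_coe_sort M fun e => f e fun j => x ⟨j, e j⟩).symm

/-- The product is at most `1` if all factors are, and otherwise at most a power of the largest
factor. -/
theorem prod_le_one_add_sum_pow {κ : Type*} [Fintype κ] (p : κ → ℝ≥0∞) {d : ℕ}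
    (hd : Fintype.card κ ≤ d) : ∏ k, p k ≤ 1 + ∑ k, p k ^ d := by
  by_cases h : ∀ k, p k ≤ 1
  · exact (Finset.prod_le_one' fun k _ => h k).trans le_self_add
  push Not at h
  obtain ⟨k₀, hk₀⟩ := h
  obtain ⟨k, -, hk⟩ := Finset.exists_max_image Finset.univ p ⟨k₀, Finset.mem_univ _⟩
  calc ∏ j, p j ≤ p k ^ Fintype.card κ := Finset.prod_le_pow_card _ _ _ hk
    _ ≤ p k ^ d := pow_le_pow_right₀ (hk₀.le.trans (hk k₀ (Finset.mem_univ _))) hd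
    _ ≤ ∑ k, p k ^ d := Finset.single_le_sum (f := fun k => p k ^ d) (fun _ _ => zero_le)
      (Finset.mem_univ k)
    _ ≤ _ := le_add_self

/-- A form of Finner's inequality: the form of a complete hypergraph is bounded as soon as the
`maxDegree W`-th moments of the functions are. The index `i₀` only witnesses `r ≠ 0`. -/
theorem completeForm_le (i₀ : Fin r) {F : (∀ j, W j) → (Fin r → ℝ) → ℝ≥0∞}
    (hF : ∀ e, Measurable (F e)) (μ : Fin r → Measure ℝ) [∀ j, IsProbabilityMeasure (μ j)]
    (h : ∀ e, ∫⁻ y, F e y ^ maxDegree W ∂Measure.pi μ ≤ 1) :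
    completeForm F μ ≤ 1 + maxDegree W := by
  classical
  obtain ⟨κ, _, c, hκ, hc⟩ := exists_matching_coloring W i₀
  set d := maxDegree W
  have hm : ∀ k, Measurable fun x : ∀ j, W j → ℝ =>
      ∏ e with c e = k, F e (fun j => x j (e j)) ^ d := fun k =>
    Finset.measurable_prod _ fun e _ => ((hF _).comp (by fun_prop)).pow_const _
  calc completeForm F μ
      ≤ ∫⁻ x, 1 + ∑ k, ∏ e with c e = k, F e (fun j => x j (e j)) ^ d ∂vertexLaw W μ := by
        refine lintegral_mono fun x => ?_
        rw [← Finset.prod_fiberwise Finset.univ c]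
        refine (prod_le_one_add_sum_pow _ hκ).trans (le_of_eq ?_)
        simp only [Finset.prod_pow]
    _ = 1 + ∑ k, ∏ e with c e = k, ∫⁻ y, F e y ^ d ∂Measure.pi μ := by
        rw [lintegral_add_left measurable_const, lintegral_finsetSum _ fun k _ => hm k]
        congr 1
        · simp
        refine Finset.sum_congr rfl fun k _ =>
          lintegral_matching _ ?_ (fun e y => F e y ^ d) (fun e => (hF e).pow_const _) μ
        intro e he e' he' j hj
        simp only [Finset.mem_filter, Finset.mem_univ, true_and] at he he'
        exact hc e e' (he.trans he'.symm) j hj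
    _ ≤ 1 + ∑ k : κ, 1 := by
        gcongr with k
        exact Finset.prod_le_one' fun e _ => h e
    _ ≤ 1 + d := by
        gcongr
        simpa using hκ

variable [∀ j, DecidableEq (W j)]

variable (W) in
/-- A bound for the Bellman function of families with moments bounded by one. -/
noncomputable def bellmanBound : ℝ≥0∞ :=
  ∑ τ : ∀ j, W j → W j, (∏ j, monomialWeight (τ j)) * (1 + maxDegree W)

variable (W) in
theorem bellmanBound_ne_top : bellmanBound W ≠ ∞ :=
  ENNReal.sum_ne_top.2 fun _ _ => ENNReal.mul_ne_top
    (ENNReal.prod_ne_top fun _ _ => monomialWeight_ne_top _) (by simp)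

theorem bellmanForm_le (i₀ : Fin r) {F : (∀ j, W j) → (Fin r → ℝ) → ℝ≥0∞}
    (hF : ∀ e, Measurable (F e)) (μ : Fin r → Measure ℝ) [∀ j, IsProbabilityMeasure (μ j)]
    (h : ∀ e, ∫⁻ y, F e y ^ maxDegree W ∂Measure.pi μ ≤ 1) :
    bellmanForm F μ ≤ bellmanBound W := by
  unfold bellmanForm bellmanBound
  gcongr
  exact completeForm_le i₀ (fun e => hF _) μ fun e => h _

end Matching

/-! ### Forms with selected vertices -/

section SignedForm

open scoped ENNReal

theorem enorm_finset_prod {ι : Type*} (s : Finset ι) (f : ι → ℝ) :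
    ‖∏ i ∈ s, f i‖ₑ = ∏ i ∈ s, ‖f i‖ₑ := by
  simp only [← ofReal_norm, norm_prod]
  exact ENNReal.ofReal_prod_of_nonneg fun _ _ => norm_nonneg _

theorem enorm_integral_mul_le {μ : Measure ℝ} {G s : ℝ → ℝ} (hG0 : ∀ t, 0 ≤ G t)
    (hs : ∀ t, |s t| ≤ 1) : ‖∫ t, G t * s t ∂μ‖ₑ ≤ ∫⁻ t, ENNReal.ofReal (G t) ∂μ := by
  refine (enorm_integral_le_lintegral_enorm _).trans (lintegral_mono fun t => ?_)
  rw [← ofReal_norm]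
  refine ENNReal.ofReal_le_ofReal ?_
  rw [norm_mul, Real.norm_of_nonneg (hG0 t)]
  exact mul_le_of_le_one_right (hG0 t) (hs t)

/-- The integral against the sign is half the difference of the means over the two halves. If `G` is
not integrable, neither is `G * σ`, because `|σ| = 1`, and the left-hand side is zero. -/
theorem enorm_integral_mul_sign_le_halfDiff {μ : Measure ℝ} {ρ : Fin 2 → Measure ℝ} {σ : ℝ → ℝ}
    (h : IsSplit μ ρ σ) {G : ℝ → ℝ} (hG : Measurable G) (hG0 : ∀ t, 0 ≤ G t) :
    ‖∫ t, G t * σ t ∂μ‖ₑ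
      ≤ halfDiff (∫⁻ t, ENNReal.ofReal (G t) ∂ρ 0) (∫⁻ t, ENNReal.ofReal (G t) ∂ρ 1) := by
  have hσ := h.measurable
  by_cases hi : Integrable G μ
  · have hiσ : Integrable (fun t => σ t * G t) μ := by
      refine hi.mono (by fun_prop) (Filter.Eventually.of_forall fun t => ?_)
      simp [h.abs_sign t]
    have hb : ∀ b : Fin 2, ∫⁻ t, ENNReal.ofReal (G t) ∂ρ b
        = ENNReal.ofReal (∫ t, (1 + (-1) ^ (b : ℕ) * σ t) * G t ∂μ) := by
      intro b
      have h0 : ∀ t, 0 ≤ 1 + (-1) ^ (b : ℕ) * σ t := fun t => by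
        have := abs_le.1 (h.abs_sign t).le
        fin_cases b
        · simp; linarith
        · simp; linarith
      rw [h.half_eq b, lintegral_withDensity_eq_lintegral_mul _ (by fun_prop) (by fun_prop),
        ofReal_integral_eq_lintegral_ofReal]
      · refine lintegral_congr fun t => ?_
        rw [Pi.mul_apply, ENNReal.ofReal_mul (h0 t)]
      · have := hi.add (hiσ.const_mul ((-1) ^ (b : ℕ)))
        refine this.congr (Filter.Eventually.of_forall fun t => ?_)
        simp only [Pi.add_apply]
        ring
      · exact Filter.Eventually.of_forall fun t => mul_nonneg (h0 t) (hG0 t)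
    have hnn : ∀ b : Fin 2, 0 ≤ ∫ t, (1 + (-1) ^ (b : ℕ) * σ t) * G t ∂μ := fun b =>
      integral_nonneg fun t => mul_nonneg (by
        have := abs_le.1 (h.abs_sign t).le
        fin_cases b
        · simp; linarith
        · simp; linarith) (hG0 t)
    have he : ∀ b : Fin 2, ∫ t, (1 + (-1) ^ (b : ℕ) * σ t) * G t ∂μ
        = ∫ t, G t ∂μ + (-1) ^ (b : ℕ) * ∫ t, σ t * G t ∂μ := fun b => by
      rw [← integral_const_mul, ← integral_add hi (hiσ.const_mul _)]
      congr 1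
      ext t
      ring
    rw [hb, hb, halfDiff_ofReal (hnn 0) (hnn 1), he, he, ← ofReal_norm]
    refine ENNReal.ofReal_le_ofReal (le_of_eq ?_)
    simp only [Fin.val_zero, Fin.val_one, pow_zero, pow_one, Real.norm_eq_abs, mul_comm (G _)]
    rw [show ∫ t, G t ∂μ + 1 * ∫ t, σ t * G t ∂μ - (∫ t, G t ∂μ + -1 * ∫ t, σ t * G t ∂μ)
      = 2 * ∫ t, σ t * G t ∂μ by ring, abs_mul, abs_two]
    ring
  · rw [integral_undef, enorm_zero]
    · exact zero_le
    · intro hi'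
      refine hi (hi'.mono (by fun_prop) (Filter.Eventually.of_forall fun t => ?_))
      simp [h.abs_sign t]

variable {r : ℕ} {W : Fin r → Type} [∀ j, Fintype (W j)]

/-- The family `F` with values in `[0, ∞]`. -/
noncomputable def ofRealFamily (F : (∀ j, W j) → (Fin r → ℝ) → ℝ) (e : ∀ j, W j) (y : Fin r → ℝ) :
    ℝ≥0∞ :=
  ENNReal.ofReal (F e y)

/-- The product of all the functions of the complete hypergraph and of the signs of the selected
variables. -/
noncomputable def signedIntegrand (F : (∀ j, W j) → (Fin r → ℝ) → ℝ) (σ : Fin r → ℝ → ℝ)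
    (S : ∀ j, Finset (W j)) (x : ∀ j, W j → ℝ) : ℝ :=
  (∏ e, F e (fun j => x j (e j))) * ∏ j, ∏ v ∈ S j, σ j (x j v)

/-- The form attached to the complete hypergraph with selected vertices `S`. -/
noncomputable def signedForm (F : (∀ j, W j) → (Fin r → ℝ) → ℝ) (μ : Fin r → Measure ℝ)
    (σ : Fin r → ℝ → ℝ) (S : ∀ j, Finset (W j)) : ℝ :=
  ∫ x, signedIntegrand F σ S x ∂vertexLaw W μ

variable {F : (∀ j, W j) → (Fin r → ℝ) → ℝ} {μ : Fin r → Measure ℝ} {ρ : Fin r → Fin 2 → Measure ℝ}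
  {σ : Fin r → ℝ → ℝ}

omit [∀ j, Fintype (W j)] in
theorem measurable_ofRealFamily (hF : ∀ e, Measurable (F e)) (e : ∀ j, W j) :
    Measurable (ofRealFamily F e) :=
  (hF e).ennreal_ofReal

theorem measurable_signedIntegrand (hF : ∀ e, Measurable (F e)) (hσ : ∀ j, Measurable (σ j))
    (S : ∀ j, Finset (W j)) : Measurable (signedIntegrand F σ S) := by
  unfold signedIntegrand
  refine (Finset.measurable_prod _ fun e _ => (hF e).comp (by fun_prop)).mul ?_
  exact Finset.measurable_prod _ fun j _ => Finset.measurable_prod _ fun v _ =>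
    (hσ j).comp (by fun_prop)

theorem enorm_signedIntegrand (hF0 : ∀ e y, 0 ≤ F e y) (hσ : ∀ j t, |σ j t| = 1)
    (S : ∀ j, Finset (W j)) (x : ∀ j, W j → ℝ) :
    ‖signedIntegrand F σ S x‖ₑ = ∏ e, ofRealFamily F e (fun j => x j (e j)) := by
  unfold signedIntegrand ofRealFamily
  rw [← ENNReal.ofReal_prod_of_nonneg fun e _ => hF0 e _, ← ofReal_norm, norm_mul, norm_prod,
    norm_prod]
  congr 1
  have : ∏ j, ‖∏ v ∈ S j, σ j (x j v)‖ = 1 := Finset.prod_eq_one fun j _ => by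
    rw [norm_prod]
    exact Finset.prod_eq_one fun v _ => hσ j _
  rw [this, mul_one]
  exact Finset.prod_congr rfl fun e _ => Real.norm_of_nonneg (hF0 e _)

theorem enorm_signedForm_le_completeForm (hF0 : ∀ e y, 0 ≤ F e y) (hσ : ∀ j t, |σ j t| = 1)
    (S : ∀ j, Finset (W j)) : ‖signedForm F μ σ S‖ₑ ≤ completeForm (ofRealFamily F) μ := by
  refine (enorm_integral_le_lintegral_enorm _).trans (le_of_eq ?_)
  exact lintegral_congr fun x => enorm_signedIntegrand hF0 hσ S x

theorem integrable_signedIntegrand (hF : ∀ e, Measurable (F e)) (hF0 : ∀ e y, 0 ≤ F e y)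
    (hσm : ∀ j, Measurable (σ j)) (hσ : ∀ j t, |σ j t| = 1)
    (hfin : completeForm (ofRealFamily F) μ ≠ ∞) (S : ∀ j, Finset (W j)) :
    Integrable (signedIntegrand F σ S) (vertexLaw W μ) := by
  refine ⟨(measurable_signedIntegrand hF hσm S).aestronglyMeasurable, ?_⟩
  unfold HasFiniteIntegral
  rw [lintegral_congr fun x => enorm_signedIntegrand hF0 hσ S x]
  exact hfin.lt_top

theorem ofReal_fiberProd (hF0 : ∀ e y, 0 ≤ F e y) (i : Fin r) (x : ∀ j, W j → ℝ) (u : W i) (t : ℝ) :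
    ENNReal.ofReal (fiberProd F i x u t) = fiberProd (ofRealFamily F) i x u t := by
  unfold fiberProd ofRealFamily
  exact ENNReal.ofReal_prod_of_nonneg fun e _ => hF0 _ _

theorem fiberProd_nonneg (hF0 : ∀ e y, 0 ≤ F e y) (i : Fin r) (x : ∀ j, W j → ℝ) (u : W i)
    (t : ℝ) : 0 ≤ fiberProd F i x u t :=
  Finset.prod_nonneg fun _ _ => hF0 _ _

variable [∀ j, DecidableEq (W j)]

/-- For fixed variables of the other parts, the integral over the variables of the part `i`
factorizes. -/
theorem enorm_signedForm_le_lintegral_prod [∀ j, IsProbabilityMeasure (μ j)]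
    (hF : ∀ e, Measurable (F e)) (hσm : ∀ j, Measurable (σ j)) (hσ : ∀ j t, |σ j t| = 1)
    (S : ∀ j, Finset (W j)) (i : Fin r) :
    ‖signedForm F μ σ S‖ₑ ≤ ∫⁻ x, ∏ v, ‖∫ t, fiberProd F i x v t *
      (if v ∈ S i then σ i t else 1) ∂μ i‖ₑ ∂vertexLaw W μ := by
  have hp := measurePreserving_vertexLaw_update W μ i (μ i)
  rw [Function.update_eq_self] at hp
  have hm := measurable_signedIntegrand hF hσm S
  have heq : signedForm F μ σ S = ∫ p : (∀ j, W j → ℝ) × (W i → ℝ),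
      signedIntegrand F σ S (Function.update p.1 i p.2)
        ∂(vertexLaw W μ).prod (Measure.pi fun _ => μ i) := by
    unfold signedForm
    rw [← hp.map_eq, integral_map hp.measurable.aemeasurable (by
      rw [hp.map_eq]; exact hm.aestronglyMeasurable), hp.map_eq]
  rw [heq]
  by_cases hi : Integrable (fun p : (∀ j, W j → ℝ) × (W i → ℝ) =>
      signedIntegrand F σ S (Function.update p.1 i p.2))
        ((vertexLaw W μ).prod (Measure.pi fun _ => μ i))
  swap
  · rw [integral_undef hi, enorm_zero]; exact zero_le
  rw [integral_prod _ hi]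
  refine (enorm_integral_le_lintegral_enorm _).trans (lintegral_mono fun x => ?_)
  have hsplit : ∀ z : W i → ℝ, signedIntegrand F σ S (Function.update x i z)
      = (∏ v, fiberProd F i x v (z v) * (if v ∈ S i then σ i (z v) else 1)) *
        ∏ j ∈ Finset.univ.erase i, ∏ v ∈ S j, σ j (x j v) := by
    intro z
    unfold signedIntegrand
    rw [prod_eq_prod_fiberProd, ← Finset.mul_prod_erase Finset.univ _ (Finset.mem_univ i),
      Finset.prod_mul_distrib, Finset.prod_ite_mem, ← mul_assoc]
    congr 1
    · simp
    · refine Finset.prod_congr rfl fun j hj => ?_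
      simp [Finset.ne_of_mem_erase hj]
  simp only [hsplit]
  rw [integral_mul_const, integral_fintype_prod_eq_prod
    (fun v t => fiberProd F i x v t * (if v ∈ S i then σ i t else 1)), enorm_mul, enorm_finset_prod]
  refine mul_le_of_le_one_right zero_le ?_
  rw [← ofReal_norm]
  simp only [norm_prod, Real.norm_eq_abs, hσ, Finset.prod_const_one, ENNReal.ofReal_one, le_refl]

theorem enorm_integral_fiberProd_le (hF0 : ∀ e y, 0 ≤ F e y) (hσ : ∀ j t, |σ j t| = 1)
    (S : ∀ j, Finset (W j)) (i : Fin r) (x : ∀ j, W j → ℝ) (v : W i) :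
    ‖∫ t, fiberProd F i x v t * (if v ∈ S i then σ i t else 1) ∂μ i‖ₑ
      ≤ fiberMean (ofRealFamily F) i (μ i) x v := by
  refine (enorm_integral_mul_le (fiberProd_nonneg hF0 i x v) fun t => ?_).trans (le_of_eq ?_)
  · split_ifs
    · exact (hσ i t).le
    · simp
  · exact lintegral_congr fun t => ofReal_fiberProd hF0 i x v t

theorem enorm_integral_fiberProd_le_halfDiff (hF : ∀ e, Measurable (F e))
    (hF0 : ∀ e y, 0 ≤ F e y) (h : ∀ j, IsSplit (μ j) (ρ j) (σ j))
    {S : ∀ j, Finset (W j)} {i : Fin r} (x : ∀ j, W j → ℝ) {v : W i} (hv : v ∈ S i) :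
    ‖∫ t, fiberProd F i x v t * (if v ∈ S i then σ i t else 1) ∂μ i‖ₑ
      ≤ halfDiff (fiberMean (ofRealFamily F) i (ρ i 0) x v)
        (fiberMean (ofRealFamily F) i (ρ i 1) x v) := by
  simp only [hv, if_true]
  have hm : Measurable (fiberProd F i x v) :=
    (measurable_fiberProd hF i v).comp (measurable_prodMk_left (x := x))
  refine (enorm_integral_mul_sign_le_halfDiff (h i) hm (fiberProd_nonneg hF0 i x v)).trans
    (le_of_eq ?_)
  unfold fiberMean
  simp only [ofReal_fiberProd hF0]

/-- If two vertices of the part `i` are selected, the form is bounded by the gains of these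
vertices. -/
theorem enorm_signedForm_le_gain_add_gain (hF : ∀ e, Measurable (F e)) (hF0 : ∀ e y, 0 ≤ F e y)
    (h : ∀ j, IsSplit (μ j) (ρ j) (σ j)) {S : ∀ j, Finset (W j)} {i : Fin r} {a b : W i}
    (ha : a ∈ S i) (hb : b ∈ S i) (hab : a ≠ b) :
    ‖signedForm F μ σ S‖ₑ ≤ bellmanGain (ofRealFamily F) μ i (ρ i) a
      + bellmanGain (ofRealFamily F) μ i (ρ i) b := by
  have := fun j => (h j).prob
  have := (h i).prob_half
  have hσ : ∀ j t, |σ j t| = 1 := fun j => (h j).abs_sign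
  have hmf : ∀ (c : Fin 2) (v : W i), Measurable fun x =>
      fiberMean (ofRealFamily F) i (ρ i c) x v := fun c v =>
    measurable_fiberMean (measurable_ofRealFamily hF) i _ v
  have hmf' : ∀ v : W i, Measurable fun x => fiberMean (ofRealFamily F) i (μ i) x v := fun v =>
    measurable_fiberMean (measurable_ofRealFamily hF) i _ v
  refine (enorm_signedForm_le_lintegral_prod hF (fun j => (h j).measurable) hσ S i).trans ?_
  unfold bellmanGain
  rw [← lintegral_add_left (by unfold halfDiff; fun_prop)]
  refine lintegral_mono fun x => ?_
  rw [← Finset.mul_prod_erase Finset.univ _ (Finset.mem_univ a),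
    ← Finset.mul_prod_erase (Finset.univ.erase a) _
      (Finset.mem_erase.2 ⟨hab.symm, Finset.mem_univ b⟩),
    ← mul_assoc, ← add_mul]
  have hrest : ∏ v ∈ (Finset.univ.erase a).erase b, ‖∫ t, fiberProd F i x v t *
      (if v ∈ S i then σ i t else 1) ∂μ i‖ₑ
        ≤ (∑ v, fiberMean (ofRealFamily F) i (μ i) x v) ^ (Fintype.card (W i) - 2) := by
    have hc : ((Finset.univ.erase a).erase b).card = Fintype.card (W i) - 2 := by
      rw [Finset.card_erase_of_mem (Finset.mem_erase.2 ⟨hab.symm, Finset.mem_univ b⟩),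
        Finset.card_erase_of_mem (Finset.mem_univ a), Finset.card_univ, Nat.sub_sub]
    rw [← hc]
    refine Finset.prod_le_pow_card _ _ _ fun v _ => ?_
    exact (enorm_integral_fiberProd_le hF0 hσ S i x v).trans
      (Finset.single_le_sum (fun _ _ => zero_le) (Finset.mem_univ v))
  refine mul_le_mul' ((mul_le_mul' (enorm_integral_fiberProd_le_halfDiff hF hF0 h x ha)
    (enorm_integral_fiberProd_le_halfDiff hF hF0 h x hb)).trans ?_) hrest
  generalize halfDiff _ _ = p
  generalize halfDiff _ _ = q
  rcases le_total p q with hpq | hpq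
  · exact (mul_le_mul_left hpq q).trans (by rw [sq q]; exact le_add_self)
  · exact (mul_le_mul_right hpq p).trans (by rw [sq p]; exact le_self_add)

theorem lintegral_sum_pow_le_bellmanForm [∀ j, IsProbabilityMeasure (μ j)]
    {F : (∀ j, W j) → (Fin r → ℝ) → ℝ≥0∞} (hF : ∀ e, Measurable (F e)) (i : Fin r) :
    ∫⁻ x, (∑ v, fiberMean F i (μ i) x v) ^ Fintype.card (W i) ∂vertexLaw W μ ≤ bellmanForm F μ := by
  conv_rhs => rw [← Function.update_eq_self i μ]
  rw [bellmanForm_update hF]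
  set τ₀ : ∀ j : {j // j ≠ i}, W j → W j := fun j => id
  refine le_trans ?_ (Finset.single_le_sum (fun _ _ => zero_le) (Finset.mem_univ τ₀))
  simp only [show (Equiv.piSplitAt i fun j => W j → W j).symm (id, τ₀) = fun j => id from
    piSplitAt_symm_id i, id]
  have hw : 1 ≤ ∏ j, monomialWeight (τ₀ j) :=
    Finset.one_le_prod' fun j _ => one_le_monomialWeight _
  refine le_trans ?_ (le_mul_of_one_le_left zero_le hw)
  exact lintegral_mono fun x => sum_pow_le_bellmanPoly _

/-- If a vertex of the part `i` is selected and this part has several vertices, the square of the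
form is bounded by the gain of that vertex. -/
theorem enorm_signedForm_sq_le_gain_mul (hF : ∀ e, Measurable (F e)) (hF0 : ∀ e y, 0 ≤ F e y)
    (h : ∀ j, IsSplit (μ j) (ρ j) (σ j)) {S : ∀ j, Finset (W j)} {i : Fin r}
    (hW : 2 ≤ Fintype.card (W i)) {a : W i} (ha : a ∈ S i) :
    ‖signedForm F μ σ S‖ₑ ^ 2 ≤ bellmanGain (ofRealFamily F) μ i (ρ i) a
      * bellmanForm (ofRealFamily F) μ := by
  have := fun j => (h j).prob
  have := (h i).prob_half
  have hσ : ∀ j t, |σ j t| = 1 := fun j => (h j).abs_sign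
  have hmf : ∀ (c : Fin 2) (v : W i), Measurable fun x =>
      fiberMean (ofRealFamily F) i (ρ i c) x v := fun c v =>
    measurable_fiberMean (measurable_ofRealFamily hF) i _ v
  have hmf' : ∀ v : W i, Measurable fun x => fiberMean (ofRealFamily F) i (μ i) x v := fun v =>
    measurable_fiberMean (measurable_ofRealFamily hF) i _ v
  obtain ⟨k, hk⟩ := Nat.exists_eq_add_of_le' hW
  refine le_trans ?_ (mul_le_mul_right
    (lintegral_sum_pow_le_bellmanForm (measurable_ofRealFamily hF) i) _)
  unfold bellmanGain
  set s : (∀ j, W j → ℝ) → ℝ≥0∞ := fun x => ∑ v, fiberMean (ofRealFamily F) i (μ i) x v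
  set δ : (∀ j, W j → ℝ) → ℝ≥0∞ := fun x => halfDiff (fiberMean (ofRealFamily F) i (ρ i 0) x a)
        (fiberMean (ofRealFamily F) i (ρ i 1) x a)
  have hs : Measurable s := by fun_prop
  have hδ : Measurable δ := by simp only [δ]; unfold halfDiff; fun_prop
  change _ ≤ (∫⁻ x, δ x ^ 2 * s x ^ (Fintype.card (W i) - 2) ∂vertexLaw W μ)
    * ∫⁻ x, s x ^ Fintype.card (W i) ∂vertexLaw W μ
  rw [hk, Nat.add_sub_cancel]
  have h1 : ‖signedForm F μ σ S‖ₑ ≤ ∫⁻ x, δ x * s x ^ (k + 1) ∂vertexLaw W μ := by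
    refine (enorm_signedForm_le_lintegral_prod hF (fun j => (h j).measurable) hσ S i).trans ?_
    refine lintegral_mono fun x => ?_
    rw [← Finset.mul_prod_erase Finset.univ _ (Finset.mem_univ a)]
    refine mul_le_mul' (enorm_integral_fiberProd_le_halfDiff hF hF0 h x ha) ?_
    have hc : (Finset.univ.erase a).card = k + 1 := by
      rw [Finset.card_erase_of_mem (Finset.mem_univ a), Finset.card_univ, hk]; rfl
    rw [← hc]
    refine Finset.prod_le_pow_card _ _ _ fun v _ => ?_
    exact (enorm_integral_fiberProd_le hF0 hσ S i x v).trans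
      (Finset.single_le_sum (f := fun v => fiberMean (ofRealFamily F) i (μ i) x v)
        (fun _ _ => zero_le) (Finset.mem_univ v))
  have hsqrt : ∀ y : ℝ≥0∞, (y ^ (1 / 2 : ℝ)) ^ 2 = y := fun y => by
    rw [← ENNReal.rpow_natCast, ← ENNReal.rpow_mul]; norm_num
  have hsqrt' : ∀ y : ℝ≥0∞, (y ^ 2) ^ (1 / 2 : ℝ) = y := fun y => by
    rw [← ENNReal.rpow_natCast, ← ENNReal.rpow_mul]; norm_num
  -- The Cauchy-Schwarz inequality for `δ * s ^ (k + 1) = (δ ^ 2 * s ^ k) ^ (1 / 2) *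
  -- (s ^ (k + 2)) ^ (1 / 2)`.
  have h2 := ENNReal.lintegral_mul_norm_pow_le (μ := vertexLaw W μ)
    (f := fun x => δ x ^ 2 * s x ^ k) (g := fun x => s x ^ (k + 2))
    (by fun_prop) (by fun_prop) (p := 1 / 2) (q := 1 / 2) (by norm_num) (by norm_num) (by norm_num)
  have h3 : ∫⁻ x, δ x * s x ^ (k + 1) ∂vertexLaw W μ
      = ∫⁻ x, (δ x ^ 2 * s x ^ k) ^ (1 / 2 : ℝ) * (s x ^ (k + 2)) ^ (1 / 2 : ℝ) ∂vertexLaw W μ := by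
    refine lintegral_congr fun x => ?_
    rw [← ENNReal.mul_rpow_of_nonneg _ _ (by norm_num),
      show δ x ^ 2 * s x ^ k * s x ^ (k + 2) = (δ x * s x ^ (k + 1)) ^ 2 by ring, hsqrt']
  rw [← h3] at h2
  calc _ ≤ ((∫⁻ x, δ x ^ 2 * s x ^ k ∂vertexLaw W μ) ^ (1 / 2 : ℝ)
        * (∫⁻ x, s x ^ (k + 2) ∂vertexLaw W μ) ^ (1 / 2 : ℝ)) ^ 2 := by
        gcongr
        exact h1.trans h2
    _ = _ := by rw [mul_pow, hsqrt, hsqrt]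

end SignedForm

/-! ### Walsh expansion over the children -/

section Fourier

open scoped ENNReal

variable {r : ℕ} {W : Fin r → Type} [∀ j, Fintype (W j)]
  {F : (∀ j, W j) → (Fin r → ℝ) → ℝ} {μ : Fin r → Measure ℝ} {ρ : Fin r → Fin 2 → Measure ℝ}
  {σ : Fin r → ℝ → ℝ}

/-- The densities of the children with respect to the parent. -/
theorem vertexLaw_children (h : ∀ j, IsSplit (μ j) (ρ j) (σ j)) (b : Fin r → Fin 2) :
    vertexLaw W (fun j => ρ j (b j)) = (vertexLaw W μ).withDensity fun x =>
      ∏ j, ∏ v, ENNReal.ofReal (1 + (-1) ^ (b j : ℕ) * σ j (x j v)) := by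
  have := fun j => (h j).prob
  have hb := fun j => (h j).prob_half (b j)
  have hm : ∀ j, Measurable fun t => ENNReal.ofReal (1 + (-1) ^ (b j : ℕ) * σ j t) := fun j => by
    have := (h j).measurable
    fun_prop
  have hin : ∀ j, (Measure.pi fun _ : W j => ρ j (b j)) =
      (Measure.pi fun _ : W j => μ j).withDensity
        fun z => ∏ v, ENNReal.ofReal (1 + (-1) ^ (b j : ℕ) * σ j (z v)) := fun j => by
    have hρ := (h j).half_eq (b j)
    have : IsProbabilityMeasure ((μ j).withDensity
        fun t => ENNReal.ofReal (1 + (-1) ^ (b j : ℕ) * σ j t)) := hρ ▸ hb j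
    rw [hρ]
    exact pi_withDensity (fun _ : W j => μ j)
      (fun _ t => ENNReal.ofReal (1 + (-1) ^ (b j : ℕ) * σ j t)) fun _ => hm j
  have : ∀ j, IsProbabilityMeasure ((Measure.pi fun _ : W j => μ j).withDensity
      fun z => ∏ v, ENNReal.ofReal (1 + (-1) ^ (b j : ℕ) * σ j (z v))) := fun j => by
    rw [← hin]; infer_instance
  unfold vertexLaw
  simp only [hin]
  exact pi_withDensity (fun j => Measure.pi fun _ : W j => μ j)
    (fun j z => ∏ v, ENNReal.ofReal (1 + (-1) ^ (b j : ℕ) * σ j (z v)))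
    fun j => Finset.measurable_prod _ fun v _ => (hm j).comp (measurable_pi_apply v)

/-- The forms without selected vertices on the children are the values of a function on the cube
`{1, -1} ^ r` whose Walsh expansion is given by the forms with selected vertices on the parent. -/
theorem signedForm_children (hF : ∀ e, Measurable (F e)) (hF0 : ∀ e y, 0 ≤ F e y)
    (h : ∀ j, IsSplit (μ j) (ρ j) (σ j)) (hfin : completeForm (ofRealFamily F) μ ≠ ∞)
    (b : Fin r → Fin 2) :
    signedForm F (fun j => ρ j (b j)) σ (fun _ => ∅)
      = ∑ S : ∀ j, Finset (W j),
          (∏ j, ((-1 : ℝ) ^ (b j : ℕ)) ^ (S j).card) * signedForm F μ σ S := by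
  have hσm := fun j => (h j).measurable
  have hσ : ∀ j t, |σ j t| = 1 := fun j => (h j).abs_sign
  have hint := integrable_signedIntegrand hF hF0 hσm hσ hfin
  have h0 : ∀ (x : ∀ j, W j → ℝ) j v, 0 ≤ 1 + (-1) ^ (b j : ℕ) * σ j (x j v) := fun x j v => by
    have h1 : |(-1) ^ (b j : ℕ) * σ j (x j v)| ≤ 1 := by
      rw [abs_mul, hσ, abs_pow, abs_neg, abs_one, one_pow, one_mul]
    linarith [(abs_le.1 h1).1]
  unfold signedForm
  rw [vertexLaw_children h, integral_withDensity_eq_integral_toReal_smul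
    (Finset.measurable_prod _ fun j _ => Finset.measurable_prod _ fun v _ => by
      have := hσm j
      fun_prop) (Filter.Eventually.of_forall fun x => ENNReal.prod_lt_top fun j _ =>
        ENNReal.prod_lt_top fun v _ => ENNReal.ofReal_lt_top)]
  simp only [← integral_const_mul]
  rw [← integral_finsetSum _ fun S _ => (hint S).const_mul _]
  congr 1
  ext x
  simp only [ENNReal.toReal_prod, ENNReal.toReal_ofReal (h0 x _ _), smul_eq_mul,
    Finset.prod_one_add]
  rw [Finset.prod_univ_sum, Finset.sum_mul]
  simp only [Finset.powerset_univ, Fintype.piFinset_univ]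
  refine Finset.sum_congr rfl fun S _ => ?_
  unfold signedIntegrand
  simp only [Finset.prod_empty, Finset.prod_const_one, mul_one, Finset.prod_mul_distrib,
    Finset.prod_const]
  ring

/-- The characters of `{1, -1} ^ r` have mean zero or are trivial. -/
theorem sum_prod_sign_pow (m : Fin r → ℕ) :
    ∑ b : Fin r → Fin 2, ∏ j, ((-1 : ℝ) ^ (b j : ℕ)) ^ m j
      = if ∀ j, Even (m j) then 2 ^ r else 0 := by
  have h := Finset.prod_univ_sum (fun _ : Fin r => (Finset.univ : Finset (Fin 2)))
    fun j c => ((-1 : ℝ) ^ (c : ℕ)) ^ m j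
  rw [Fintype.piFinset_univ] at h
  rw [← h]
  simp only [Fin.sum_univ_two, Fin.val_zero, Fin.val_one, pow_zero, pow_one, one_pow]
  split_ifs with hm
  · rw [Finset.prod_congr rfl fun j _ => by rw [(hm j).neg_one_pow]]
    norm_num
  · push Not at hm
    obtain ⟨j, hj⟩ := hm
    refine Finset.prod_eq_zero (Finset.mem_univ j) ?_
    rw [(Nat.not_even_iff_odd.1 hj).neg_one_pow]
    norm_num

theorem abs_prod_sign_pow (b : Fin r → Fin 2) (m : Fin r → ℕ) :
    |∏ j, ((-1 : ℝ) ^ (b j : ℕ)) ^ m j| = 1 := by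
  rw [Finset.abs_prod]
  exact Finset.prod_eq_one fun j _ => by simp [abs_pow]

/-- The total size of the forms in which some part has at least two selected vertices. -/
noncomputable def multiForm (F : (∀ j, W j) → (Fin r → ℝ) → ℝ) (μ : Fin r → Measure ℝ)
    (σ : Fin r → ℝ → ℝ) : ℝ :=
  ∑ S : ∀ j, Finset (W j) with ∃ j, 2 ≤ (S j).card, |signedForm F μ σ S|

/-- A Walsh coefficient of the forms on the children agrees with the form on the parent for the
corresponding selection `U`, up to forms with two selected vertices in some part, provided that
no other selection with at most one vertex in each part has the same parities. -/
theorem abs_walsh_sub_le (hF : ∀ e, Measurable (F e)) (hF0 : ∀ e y, 0 ≤ F e y)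
    (h : ∀ j, IsSplit (μ j) (ρ j) (σ j)) (hfin : completeForm (ofRealFamily F) μ ≠ ∞)
    (U : ∀ j, Finset (W j)) (hU1 : ∀ j, (U j).card ≤ 1)
    (hU : ∀ S : ∀ j, Finset (W j), (∀ j, (S j).card ≤ 1) → S ≠ U →
      ∃ j, ¬ Even ((U j).card + (S j).card)) :
    |∑ b : Fin r → Fin 2, (∏ j, ((-1 : ℝ) ^ (b j : ℕ)) ^ (U j).card) *
        signedForm F (fun j => ρ j (b j)) σ (fun _ => ∅) - 2 ^ r * signedForm F μ σ U|
      ≤ 2 ^ r * multiForm F μ σ := by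
  have hsum : ∑ b : Fin r → Fin 2, (∏ j, ((-1 : ℝ) ^ (b j : ℕ)) ^ (U j).card) *
        signedForm F (fun j => ρ j (b j)) σ (fun _ => ∅)
      = ∑ S : ∀ j, Finset (W j),
        (if ∀ j, Even ((U j).card + (S j).card) then 2 ^ r else 0) * signedForm F μ σ S := by
    simp only [signedForm_children hF hF0 h hfin, Finset.mul_sum]
    rw [Finset.sum_comm]
    refine Finset.sum_congr rfl fun S _ => ?_
    rw [← sum_prod_sign_pow, Finset.sum_mul]
    refine Finset.sum_congr rfl fun b _ => ?_
    simp only [pow_add, Finset.prod_mul_distrib]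
    ring
  rw [hsum, ← Finset.sum_filter_add_sum_filter_not Finset.univ
    fun S : ∀ j, Finset (W j) => ∃ j, 2 ≤ (S j).card]
  have hgood : ∑ S : ∀ j, Finset (W j) with ¬ ∃ j, 2 ≤ (S j).card,
      (if ∀ j, Even ((U j).card + (S j).card) then (2 : ℝ) ^ r else 0) * signedForm F μ σ S
        = 2 ^ r * signedForm F μ σ U := by
    rw [Finset.sum_eq_single U]
    · rw [if_pos fun j => ⟨_, rfl⟩]
    · intro S hS hne
      simp only [Finset.mem_filter, Finset.mem_univ, true_and, not_exists, not_le] at hS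
      obtain ⟨j, hj⟩ := hU S (fun j => Nat.lt_succ_iff.1 (hS j)) hne
      rw [if_neg fun hall => hj (hall j), zero_mul]
    · intro hn
      refine absurd (Finset.mem_filter.2 ⟨Finset.mem_univ U, ?_⟩) hn
      push Not
      exact fun j => Nat.lt_succ_iff.2 (hU1 j)
  rw [hgood, add_sub_cancel_right, multiForm, Finset.mul_sum]
  refine (Finset.abs_sum_le_sum_abs _ _).trans (Finset.sum_le_sum fun S _ => ?_)
  rw [abs_mul]
  refine mul_le_mul_of_nonneg_right ?_ (abs_nonneg _)
  split_ifs <;> simp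

/-- Bessel's inequality for the forms on the children, when all the selected vertices lie in parts
with a single vertex. -/
theorem sq_add_sq_le_sum_children (hF : ∀ e, Measurable (F e)) (hF0 : ∀ e y, 0 ≤ F e y)
    (h : ∀ j, IsSplit (μ j) (ρ j) (σ j)) (hfin : completeForm (ofRealFamily F) μ ≠ ∞)
    {S : ∀ j, Finset (W j)} (hS : ∀ j, (S j).Nonempty → Fintype.card (W j) ≤ 1) {i : Fin r}
    (hi : (S i).Nonempty) {K : ℝ} (hK : ∀ U, |signedForm F μ σ U| ≤ K) :
    2 ^ r * (signedForm F μ σ (fun _ => ∅) ^ 2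
        + (signedForm F μ σ S ^ 2 - 4 * K * multiForm F μ σ))
      ≤ ∑ b : Fin r → Fin 2, signedForm F (fun j => ρ j (b j)) σ (fun _ => ∅) ^ 2 := by
  have hS1 : ∀ j, (S j).card ≤ 1 := fun j => by
    rcases (S j).eq_empty_or_nonempty with he | hne
    · simp [he]
    · exact (Finset.card_le_univ _).trans (hS j hne)
  -- The selections `∅` and `S` are the only ones with at most one vertex in each part and the same
  -- parities: in the parts which `S` meets there is just one vertex.
  have h1 := abs_walsh_sub_le hF hF0 h hfin (fun _ => ∅) (fun _ => by simp) (by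
    intro S' hS' hne
    obtain ⟨j, hj⟩ := Function.ne_iff.1 hne
    refine ⟨j, ?_⟩
    have : (S' j).card = 1 :=
      le_antisymm (hS' j) (Finset.card_pos.2 (Finset.nonempty_iff_ne_empty.2 hj))
    simp [this])
  have h2 := abs_walsh_sub_le hF hF0 h hfin S hS1 (by
    intro S' hS' hne
    obtain ⟨j, hj⟩ := Function.ne_iff.1 hne
    refine ⟨j, fun hev => hj ?_⟩
    rcases (S j).eq_empty_or_nonempty with he | hn
    · rw [he, Finset.card_empty, zero_add] at hev
      have h3 := hS' j
      interval_cases hc : (S' j).card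
      · rw [he, Finset.card_eq_zero.1 hc]
      · exact absurd hev (by decide)
    · have hc : (S j).card = 1 := le_antisymm (hS1 j) (Finset.card_pos.2 hn)
      rw [hc] at hev
      have h3 := hS' j
      interval_cases hc' : (S' j).card
      · exact absurd hev (by decide)
      · have huniv : ∀ T : Finset (W j), T.card = 1 → T = Finset.univ := fun T hT =>
          Finset.eq_univ_of_card T (le_antisymm (Finset.card_le_univ T) (hT ▸ hS j hn))
        rw [huniv _ hc, huniv _ hc'])
  set X : (Fin r → Fin 2) → ℝ := fun b => signedForm F (fun j => ρ j (b j)) σ (fun _ => ∅)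
  set ε : (Fin r → Fin 2) → ℝ := fun b => ∏ j, ((-1 : ℝ) ^ (b j : ℕ)) ^ (S j).card
  set p := signedForm F μ σ (fun _ => ∅)
  set q := signedForm F μ σ S
  set E := multiForm F μ σ
  have hε2 : ∀ b, ε b ^ 2 = 1 := fun b => by
    rw [← sq_abs, abs_prod_sign_pow, one_pow]
  have hε0 : ∑ b, ε b = 0 := by
    simp only [ε]
    rw [sum_prod_sign_pow, if_neg]
    intro hall
    have : (S i).card = 1 := le_antisymm (hS1 i) (Finset.card_pos.2 hi)
    exact absurd (hall i) (by rw [this]; decide)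
  have hE0 : 0 ≤ E := Finset.sum_nonneg fun _ _ => abs_nonneg _
  -- Bessel's inequality for the orthonormal functions `1` and `ε`, with approximate coefficients.
  have hpos : 0 ≤ ∑ b, (X b - p - ε b * q) ^ 2 := Finset.sum_nonneg fun b _ => sq_nonneg _
  have hexp : ∑ b, (X b - p - ε b * q) ^ 2
      = ∑ b, X b ^ 2 - 2 * p * ∑ b, X b - 2 * q * ∑ b, ε b * X b + 2 ^ r * (p ^ 2 + q ^ 2) := by
    have : ∀ b, (X b - p - ε b * q) ^ 2
        = X b ^ 2 - 2 * p * X b - 2 * q * (ε b * X b) + (p ^ 2 + q ^ 2) + 2 * p * q * ε b := by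
      intro b
      linear_combination q ^ 2 * hε2 b
    simp only [this, Finset.sum_add_distrib, Finset.sum_sub_distrib, ← Finset.mul_sum, hε0]
    simp
    ring
  simp only [Finset.card_empty, pow_zero, Finset.prod_const_one, one_mul] at h1
  have hx : ∀ (a Y : ℝ), |a| ≤ K → |Y - 2 ^ r * a| ≤ 2 ^ r * E →
      2 ^ r * a ^ 2 - 2 ^ r * (K * E) ≤ a * Y := fun a Y ha hY => by
    have h3 : |a * (Y - 2 ^ r * a)| ≤ K * (2 ^ r * E) := by
      rw [abs_mul]
      exact mul_le_mul ha hY (abs_nonneg _) ((abs_nonneg _).trans ha)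
    linarith [(abs_le.1 h3).1]
  have hp := hx p _ (hK _) h1
  have hq := hx q _ (hK _) h2
  linarith

end Fourier

/-! ### Uniform laws, dyadic cubes and telescoping -/

section UniformLaw

open scoped ENNReal

/-- The uniform probability measure on the interval `[a, b)`. -/
noncomputable def uniformLaw (a b : ℝ) : Measure ℝ :=
  (ENNReal.ofReal (b - a))⁻¹ • volume.restrict (Set.Ico a b)

/-- The sign that is `1` on the left half of `[a, b)` and `-1` on the right half. It extends the
cancellative Haar function, normalized in `L^∞`, to a function of absolute value one. -/
noncomputable def halfSign (a b t : ℝ) : ℝ := if t < (a + b) / 2 then 1 else -1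

theorem isProbabilityMeasure_uniformLaw {a b : ℝ} (h : a < b) :
    IsProbabilityMeasure (uniformLaw a b) := by
  refine ⟨?_⟩
  unfold uniformLaw
  rw [Measure.smul_apply, Measure.restrict_apply_univ, Real.volume_Ico, smul_eq_mul]
  exact ENNReal.inv_mul_cancel (by simpa using h) ENNReal.ofReal_ne_top

theorem measurable_halfSign (a b : ℝ) : Measurable (halfSign a b) :=
  Measurable.ite measurableSet_Iio measurable_const measurable_const

/-- A half of the interval `[a, b)`, written as `[a', b')`, has density `1 ± halfSign a b`. -/
theorem uniformLaw_half {a b a' b' s : ℝ} (hab : b' - a' = (b - a) / 2)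
    (hs : ∀ t ∈ Set.Ico a b,
      1 + s * halfSign a b t = (Set.Ico a' b').indicator (fun _ => 2) t)
    (hsub : Set.Ico a' b' ⊆ Set.Ico a b) :
    uniformLaw a' b'
      = (uniformLaw a b).withDensity fun t => ENNReal.ofReal (1 + s * halfSign a b t) := by
  have hm : Measurable fun t => ENNReal.ofReal (1 + s * halfSign a b t) := by
    have := measurable_halfSign a b
    fun_prop
  ext A hA
  unfold uniformLaw
  rw [withDensity_smul_measure, Measure.smul_apply, Measure.smul_apply, withDensity_apply _ hA,
    Measure.restrict_restrict hA, Measure.restrict_apply hA]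
  have : ∫⁻ t in A ∩ Set.Ico a b, ENNReal.ofReal (1 + s * halfSign a b t)
      = 2 * volume (A ∩ Set.Ico a' b') := by
    rw [setLIntegral_congr_fun (g := fun t => (Set.Ico a' b').indicator (fun _ => 2) t)
      (hA.inter measurableSet_Ico) fun t ht => by
        rw [hs t ht.2]
        by_cases h' : t ∈ Set.Ico a' b' <;> simp [h']]
    rw [lintegral_indicator measurableSet_Ico, setLIntegral_const,
      Measure.restrict_apply measurableSet_Ico]
    congr 2
    ext t
    constructor
    · rintro ⟨h1, h2, -⟩
      exact ⟨h2, h1⟩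
    · rintro ⟨h1, h2⟩
      exact ⟨h2, h1, hsub h2⟩
  rw [this, hab, smul_eq_mul, smul_eq_mul, ← mul_assoc, ENNReal.ofReal_div_of_pos two_pos,
    ENNReal.inv_div (by simp) (by simp), ENNReal.div_eq_inv_mul, ENNReal.ofReal_ofNat]

theorem isSplit_uniformLaw {a b : ℝ} (h : a < b) (ρ : Fin 2 → Measure ℝ)
    (h0 : ρ 0 = uniformLaw a ((a + b) / 2)) (h1 : ρ 1 = uniformLaw ((a + b) / 2) b) :
    IsSplit (uniformLaw a b) ρ (halfSign a b) where
  prob := isProbabilityMeasure_uniformLaw h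
  prob_half c := by
    fin_cases c
    · simpa only [Fin.zero_eta, h0] using isProbabilityMeasure_uniformLaw (by linarith)
    · simpa only [Fin.mk_one, h1] using isProbabilityMeasure_uniformLaw (by linarith)
  measurable := measurable_halfSign a b
  abs_sign t := by unfold halfSign; split_ifs <;> simp
  half_eq c := by
    fin_cases c
    · simp only [Fin.zero_eta, h0]
      refine uniformLaw_half (by ring) (fun t ht => ?_) (Set.Ico_subset_Ico_right (by linarith))
      unfold halfSign
      by_cases h' : t < (a + b) / 2
      · rw [Set.indicator_of_mem (show t ∈ Set.Ico a ((a + b) / 2) from ⟨ht.1, h'⟩)]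
        simp [h']; norm_num
      · rw [Set.indicator_of_notMem fun hh => h' hh.2]; simp [h']
    · simp only [Fin.mk_one, h1]
      refine uniformLaw_half (by ring) (fun t ht => ?_) (Set.Ico_subset_Ico_left (by linarith))
      unfold halfSign
      by_cases h' : t < (a + b) / 2
      · rw [Set.indicator_of_notMem fun hh => hh.1.not_gt h']; simp [h']
      · rw [Set.indicator_of_mem (show t ∈ Set.Ico ((a + b) / 2) b from ⟨not_lt.1 h', ht.2⟩)]
        simp [h']; norm_num

theorem pi_uniformLaw {ι : Type*} [Fintype ι] {a b : ι → ℝ} (h : ∀ i, a i < b i) :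
    Measure.pi (fun i => uniformLaw (a i) (b i)) = (∏ i, ENNReal.ofReal (b i - a i))⁻¹ •
      (volume : Measure (ι → ℝ)).restrict (Set.univ.pi fun i => Set.Ico (a i) (b i)) := by
  have := fun i => isProbabilityMeasure_uniformLaw (h i)
  refine Measure.pi_eq fun s hs => ?_
  rw [Measure.smul_apply, Measure.restrict_apply (MeasurableSet.univ_pi hs), ← Set.pi_inter_distrib,
    volume_pi_pi, smul_eq_mul, ENNReal.prod_inv_distrib (fun _ _ _ _ _ => Or.inr (by simp)),
    ← Finset.prod_mul_distrib]
  refine Finset.prod_congr rfl fun i _ => ?_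
  unfold uniformLaw
  rw [Measure.smul_apply, Measure.restrict_apply (hs i), smul_eq_mul]

end UniformLaw

namespace DyadicCube

variable {r : ℕ}

theorem scale_pos (Q : DyadicCube r) : (0 : ℝ) < 2 ^ Q.scale := by positivity

theorem hi_sub_lo (Q : DyadicCube r) (i : Fin r) : Q.hi i - Q.lo i = 2 ^ Q.scale := by
  unfold hi lo; ring

theorem lo_lt_hi (Q : DyadicCube r) (i : Fin r) : Q.lo i < Q.hi i := by
  have := Q.hi_sub_lo i
  linarith [Q.scale_pos]

theorem toSet_eq_pi (Q : DyadicCube r) :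
    Q.toSet = Set.univ.pi fun i => Set.Ico (Q.lo i) (Q.hi i) := by
  ext x; simp [toSet]

theorem volume_toSet (Q : DyadicCube r) :
    volume Q.toSet = ∏ i, ENNReal.ofReal (Q.hi i - Q.lo i) := by
  rw [toSet_eq_pi, volume_pi_pi]
  simp

theorem vol_eq (Q : DyadicCube r) : Q.vol = ((2 : ℝ) ^ Q.scale) ^ r := by
  unfold vol Measure.real
  rw [volume_toSet]
  simp only [hi_sub_lo, Finset.prod_const, Finset.card_univ, Fintype.card_fin, ENNReal.toReal_pow,
    ENNReal.toReal_ofReal Q.scale_pos.le]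

theorem vol_pos (Q : DyadicCube r) : 0 < Q.vol := by
  rw [vol_eq]; exact pow_pos Q.scale_pos r

/-- The child of a cube with a given position in each coordinate. -/
def child (Q : DyadicCube r) (b : Fin r → Fin 2) : DyadicCube r :=
  ⟨Q.scale - 1, fun i => 2 * Q.coord i + ((b i : ℕ) : ℤ)⟩

theorem children_eq (Q : DyadicCube r) [DecidableEq (DyadicCube r)] :
    Q.children = Finset.univ.image Q.child := by
  unfold children
  congr!

theorem child_injective2 {Q Q' : DyadicCube r} {b b' : Fin r → Fin 2}
    (h : Q.child b = Q'.child b') : Q = Q' ∧ b = b' := by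
  have h1 : Q.scale - 1 = Q'.scale - 1 := congrArg DyadicCube.scale h
  have h2 : ∀ i, 2 * Q.coord i + ((b i : ℕ) : ℤ) = 2 * Q'.coord i + ((b' i : ℕ) : ℤ) := fun i =>
    congrFun (congrArg DyadicCube.coord h) i
  refine ⟨DyadicCube.ext (by omega) (funext fun i => ?_), funext fun i => Fin.ext ?_⟩
  · have := h2 i; have := (b i).2; have := (b' i).2; omega
  · have := h2 i; have := (b i).2; have := (b' i).2; omega

theorem vol_child (Q : DyadicCube r) (b : Fin r → Fin 2) : 2 ^ r * (Q.child b).vol = Q.vol := by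
  rw [vol_eq, vol_eq, ← mul_pow]
  congr 1
  change 2 * (2 : ℝ) ^ (Q.scale - 1) = _
  rw [zpow_sub_one₀ two_ne_zero]
  ring

theorem toSet_subset_iff {Q R : DyadicCube r} :
    Q.toSet ⊆ R.toSet ↔ ∀ i, R.lo i ≤ Q.lo i ∧ Q.hi i ≤ R.hi i := by
  rw [toSet_eq_pi, toSet_eq_pi, Set.pi_subset_pi_iff]
  have hne : (Set.univ.pi fun i => Set.Ico (Q.lo i) (Q.hi i)) ≠ ∅ := by
    rw [← Set.nonempty_iff_ne_empty, Set.univ_pi_nonempty_iff]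
    exact fun i => ⟨_, Set.left_mem_Ico.2 (Q.lo_lt_hi i)⟩
  simp only [hne, or_false, Set.mem_univ, true_imp_iff,
    fun i => Set.Ico_subset_Ico_iff (Q.lo_lt_hi i)]

theorem scale_le_of_subset (hr : r ≠ 0) {Q R : DyadicCube r} (h : Q.toSet ⊆ R.toSet) :
    Q.scale ≤ R.scale := by
  have hi := toSet_subset_iff.1 h ⟨0, Nat.pos_of_ne_zero hr⟩
  have h1 : (2 : ℝ) ^ Q.scale ≤ 2 ^ R.scale := by
    rw [← hi_sub_lo Q ⟨0, Nat.pos_of_ne_zero hr⟩, ← hi_sub_lo R ⟨0, Nat.pos_of_ne_zero hr⟩]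
    linarith
  exact (zpow_le_zpow_iff_right₀ one_lt_two).1 h1

/-- The parent of a cube. -/
def parent (Q : DyadicCube r) : DyadicCube r := ⟨Q.scale + 1, fun i => Q.coord i / 2⟩

theorem exists_child_parent (Q : DyadicCube r) : ∃ b, Q.parent.child b = Q := by
  refine ⟨fun i => ⟨(Q.coord i % 2).toNat, by omega⟩, DyadicCube.ext ?_ (funext fun i => ?_)⟩
  · simp [parent, child]
  · simp only [parent, child]
    omega

theorem lo_parent (Q : DyadicCube r) (i : Fin r) :
    Q.parent.lo i = 2 ^ Q.scale * ((2 * (Q.coord i / 2) : ℤ) : ℝ) := by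
  simp only [parent, lo, zpow_add_one₀ (two_ne_zero (α := ℝ))]
  push_cast
  ring

theorem hi_parent (Q : DyadicCube r) (i : Fin r) :
    Q.parent.hi i = 2 ^ Q.scale * ((2 * (Q.coord i / 2) + 2 : ℤ) : ℝ) := by
  simp only [parent, hi, zpow_add_one₀ (two_ne_zero (α := ℝ))]
  push_cast
  ring

theorem subset_parent (Q : DyadicCube r) : Q.toSet ⊆ Q.parent.toSet := by
  refine toSet_subset_iff.2 fun i => ?_
  have h1 : 2 * (Q.coord i / 2) ≤ Q.coord i := by omega
  have h2 : Q.coord i + 1 ≤ 2 * (Q.coord i / 2) + 2 := by omega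
  rw [lo_parent, hi_parent]
  refine ⟨mul_le_mul_of_nonneg_left (by exact_mod_cast h1) Q.scale_pos.le,
    mul_le_mul_of_nonneg_left (by exact_mod_cast h2) Q.scale_pos.le⟩

/-- A dyadic cube properly contained in `R` has a strictly smaller scale, so its parent is still
contained in `R`. -/
theorem parent_subset (hr : r ≠ 0) {Q R : DyadicCube r} (h : Q.toSet ⊆ R.toSet) (hne : Q ≠ R) :
    Q.parent.toSet ⊆ R.toSet := by
  have hlt : Q.scale < R.scale := by
    refine lt_of_le_of_ne (scale_le_of_subset hr h) fun heq => hne (DyadicCube.ext heq ?_)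
    ext i
    obtain ⟨h1, h2⟩ := toSet_subset_iff.1 h i
    unfold lo at h1
    unfold hi at h2
    rw [← heq] at h1 h2
    have h1' := le_of_mul_le_mul_left h1 Q.scale_pos
    have h2' := le_of_mul_le_mul_left h2 Q.scale_pos
    norm_cast at h1' h2'
    omega
  obtain ⟨m, hm⟩ := Int.le.dest (show Q.scale + 1 ≤ R.scale by omega)
  have hscale : (2 : ℝ) ^ R.scale = 2 ^ Q.scale * (2 * 2 ^ m) := by
    rw [← hm, zpow_add₀ two_ne_zero, zpow_add_one₀ two_ne_zero, zpow_natCast]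
    ring
  refine toSet_subset_iff.2 fun i => ?_
  obtain ⟨h1, h2⟩ := toSet_subset_iff.1 h i
  rw [lo_parent, hi_parent]
  unfold lo at h1 ⊢
  unfold hi at h2 ⊢
  simp only [hscale, mul_assoc] at h1 h2 ⊢
  have h1' := le_of_mul_le_mul_left h1 Q.scale_pos
  have h2' := le_of_mul_le_mul_left h2 Q.scale_pos
  have h1'' : 2 * (2 ^ m * R.coord i) ≤ Q.coord i := by exact_mod_cast h1'
  have h2'' : Q.coord i + 1 ≤ 2 * (2 ^ m * (R.coord i + 1)) := by exact_mod_cast h2'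
  generalize hX : (2 : ℤ) ^ m * R.coord i = X at h1''
  generalize hY : (2 : ℤ) ^ m * (R.coord i + 1) = Y at h2''
  have h3 : 2 * X ≤ 2 * (Q.coord i / 2) := by omega
  have h4 : 2 * (Q.coord i / 2) + 2 ≤ 2 * Y := by omega
  rw [← hX] at h3
  rw [← hY] at h4
  refine ⟨mul_le_mul_of_nonneg_left (by exact_mod_cast h3) Q.scale_pos.le,
    mul_le_mul_of_nonneg_left (by exact_mod_cast h4) Q.scale_pos.le⟩

/-- The uniform laws on the sides of a cube. -/
noncomputable def sideLaw (Q : DyadicCube r) (i : Fin r) : Measure ℝ := uniformLaw (Q.lo i) (Q.hi i)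

/-- The signs on the sides of a cube. -/
noncomputable def sideSign (Q : DyadicCube r) (i : Fin r) : ℝ → ℝ := halfSign (Q.lo i) (Q.hi i)

/-- The uniform laws on the halves of the sides of a cube. -/
noncomputable def halfSideLaw (Q : DyadicCube r) (i : Fin r) (c : Fin 2) : Measure ℝ :=
  (Q.child fun _ => c).sideLaw i

theorem sideLaw_child (Q : DyadicCube r) (b : Fin r → Fin 2) :
    (Q.child b).sideLaw = fun j => Q.halfSideLaw j (b j) := rfl

instance (Q : DyadicCube r) (i : Fin r) : IsProbabilityMeasure (Q.sideLaw i) :=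
  isProbabilityMeasure_uniformLaw (Q.lo_lt_hi i)

theorem isSplit_sideLaw (Q : DyadicCube r) (i : Fin r) :
    IsSplit (Q.sideLaw i) (Q.halfSideLaw i) (Q.sideSign i) := by
  refine isSplit_uniformLaw (Q.lo_lt_hi i) _ ?_ ?_
  · unfold halfSideLaw sideLaw
    congr 1
    · simp only [child, lo, zpow_sub_one₀ (two_ne_zero (α := ℝ))]
      simp
      ring
    · simp only [child, lo, hi, zpow_sub_one₀ (two_ne_zero (α := ℝ))]
      simp
      ring
  · unfold halfSideLaw sideLaw
    congr 1
    · simp only [child, lo, hi, zpow_sub_one₀ (two_ne_zero (α := ℝ))]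
      simp
      ring
    · simp only [child, hi, zpow_sub_one₀ (two_ne_zero (α := ℝ))]
      simp
      ring

end DyadicCube

section Tree

variable {r : ℕ} {T : Finset (DyadicCube r)} {R : DyadicCube r}

open Classical in
/-- Each cube of the tree except the root, and each leaf, is a child of exactly one cube of the
tree. -/
theorem IsConvexTree.sum_sum_child (hT : IsConvexTree T R) (hr : r ≠ 0) (φ : DyadicCube r → ℝ) :
    ∑ Q ∈ T, ∑ b, φ (Q.child b) = ∑ Q ∈ T.erase R, φ Q + ∑ Q ∈ leaves T, φ Q := by
  have h1 : ∑ Q ∈ T, ∑ b, φ (Q.child b) = ∑ Q ∈ T.biUnion DyadicCube.children, φ Q := by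
    rw [Finset.sum_biUnion]
    · refine Finset.sum_congr rfl fun Q _ => ?_
      rw [DyadicCube.children_eq, Finset.sum_image]
      exact fun b _ b' _ h => (DyadicCube.child_injective2 h).2
    · intro Q _ Q' _ hne
      refine Finset.disjoint_left.2 fun P hP hP' => hne ?_
      rw [DyadicCube.children_eq, Finset.mem_image] at hP hP'
      obtain ⟨b, -, hb⟩ := hP
      obtain ⟨b', -, hb'⟩ := hP'
      exact (DyadicCube.child_injective2 (hb.trans hb'.symm)).1
  rw [h1, ← Finset.sum_inter_add_sum_sdiff (T.biUnion DyadicCube.children) T]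
  congr 1
  refine Finset.sum_congr ?_ fun _ _ => rfl
  ext Q
  simp only [Finset.mem_inter, Finset.mem_biUnion, Finset.mem_erase, DyadicCube.children_eq,
    Finset.mem_image, Finset.mem_univ, true_and]
  constructor
  · rintro ⟨⟨P, hP, b, rfl⟩, hQ⟩
    refine ⟨fun heq => ?_, hQ⟩
    have := DyadicCube.scale_le_of_subset hr (hT.subset_root P hP)
    rw [← heq] at this
    change P.scale ≤ P.scale - 1 at this
    omega
  · rintro ⟨hne, hQ⟩
    obtain ⟨b, hb⟩ := Q.exists_child_parent
    exact ⟨⟨Q.parent, hT.convex Q hQ R hT.root_mem _ Q.subset_parent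
      (DyadicCube.parent_subset hr (hT.subset_root Q hQ) hne), b, hb⟩, hQ⟩

theorem subset_treeAndLeaves : T ⊆ treeAndLeaves T := by
  classical
  exact Finset.subset_union_left

theorem child_mem_treeAndLeaves {Q : DyadicCube r} (hQ : Q ∈ T)
    (b : Fin r → Fin 2) : Q.child b ∈ treeAndLeaves T := by
  classical
  unfold treeAndLeaves leaves
  simp only [Finset.mem_union, Finset.mem_sdiff, Finset.mem_biUnion, DyadicCube.children_eq,
    Finset.mem_image]
  by_cases h : Q.child b ∈ T
  · exact Or.inl h
  · exact Or.inr ⟨⟨Q, hQ, b, Finset.mem_univ _, rfl⟩, h⟩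

/-- Telescoping: if the average of `f` over the children of each cube of the tree exceeds its value
on the cube by at least `g`, the total of `g` over the tree is controlled by the values of `f` on
the leaves. -/
theorem IsConvexTree.sum_vol_mul_le (hT : IsConvexTree T R) (hr : r ≠ 0) {f g : DyadicCube r → ℝ}
    {K : ℝ} (hR : 0 ≤ f R) (hK : ∀ Q ∈ treeAndLeaves T, f Q ≤ K)
    (h : ∀ Q ∈ T, 2 ^ r * (f Q + g Q) ≤ ∑ b, f (Q.child b)) :
    ∑ Q ∈ T, Q.vol * g Q ≤ K * R.vol := by
  classical
  have hvol := hT.sum_sum_child hr DyadicCube.vol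
  have h1 : ∀ Q : DyadicCube r, ∑ b, (Q.child b).vol = Q.vol := fun Q => by
    have h2 : ∀ b, (Q.child b).vol = Q.vol / 2 ^ r := fun b => by
      rw [← Q.vol_child b]; field_simp
    simp only [h2, Finset.sum_const, Finset.card_univ, Fintype.card_fun, Fintype.card_fin,
      nsmul_eq_mul]
    push_cast
    field_simp
  have hf := hT.sum_sum_child hr fun Q => Q.vol * f Q
  have h3 : ∑ Q ∈ T, Q.vol * (f Q + g Q) ≤ ∑ Q ∈ T, ∑ b, (Q.child b).vol * f (Q.child b) := by
    refine Finset.sum_le_sum fun Q hQ => ?_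
    have h2 : ∀ b, (Q.child b).vol = Q.vol / 2 ^ r := fun b => by
      rw [← Q.vol_child b]; field_simp
    simp only [h2, ← Finset.mul_sum]
    have := mul_le_mul_of_nonneg_left (h Q hQ)
      (div_nonneg Q.vol_pos.le (by positivity : (0 : ℝ) ≤ 2 ^ r))
    refine le_trans (le_of_eq ?_) this
    field_simp
  have h4 : ∑ Q ∈ leaves T, Q.vol * f Q ≤ K * ∑ Q ∈ leaves T, Q.vol := by
    rw [Finset.mul_sum]
    refine Finset.sum_le_sum fun Q hQ => ?_
    rw [mul_comm]
    exact mul_le_mul_of_nonneg_right (hK Q (Finset.mem_union_right _ hQ)) Q.vol_pos.le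
  simp only [h1, mul_add, Finset.sum_add_distrib] at hvol h3
  rw [hf] at h3
  have e1 := Finset.add_sum_erase T DyadicCube.vol hT.root_mem
  have e2 := Finset.add_sum_erase T (fun Q => Q.vol * f Q) hT.root_mem
  -- The case `f = 1` of the telescoping identity: the leaves partition the root.
  have e3 : ∑ Q ∈ leaves T, Q.vol = R.vol := by linarith
  rw [e3] at h4
  have h5 := mul_nonneg R.vol_pos.le hR
  linarith

end Tree

/-! ### Complete hypergraphs on a tree -/

section CompleteTree

open scoped ENNReal

variable {r : ℕ} {W : Fin r → Type} [∀ j, Fintype (W j)]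
  {F : (∀ j, W j) → (Fin r → ℝ) → ℝ} {T : Finset (DyadicCube r)} {R : DyadicCube r}

/-- The evaluation on a cube of the form of the complete hypergraph with selected vertices `S`. -/
noncomputable def cubeForm (F : (∀ j, W j) → (Fin r → ℝ) → ℝ) (Q : DyadicCube r)
    (S : ∀ j, Finset (W j)) : ℝ :=
  signedForm F Q.sideLaw Q.sideSign S

theorem completeForm_sideLaw_le (i₀ : Fin r) {Q : DyadicCube r} (hF : ∀ e, Measurable (F e))
    (hQ : ∀ e, ∫⁻ y, ofRealFamily F e y ^ maxDegree W ∂Measure.pi Q.sideLaw ≤ 1) :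
    completeForm (ofRealFamily F) Q.sideLaw ≤ 1 + maxDegree W :=
  completeForm_le i₀ (measurable_ofRealFamily hF) _ hQ

theorem completeForm_sideLaw_ne_top (i₀ : Fin r) {Q : DyadicCube r} (hF : ∀ e, Measurable (F e))
    (hQ : ∀ e, ∫⁻ y, ofRealFamily F e y ^ maxDegree W ∂Measure.pi Q.sideLaw ≤ 1) :
    completeForm (ofRealFamily F) Q.sideLaw ≠ ∞ :=
  ne_top_of_le_ne_top (by simp) (completeForm_sideLaw_le i₀ hF hQ)

theorem abs_cubeForm_le (i₀ : Fin r) {Q : DyadicCube r} (hF : ∀ e, Measurable (F e))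
    (hF0 : ∀ e y, 0 ≤ F e y)
    (hQ : ∀ e, ∫⁻ y, ofRealFamily F e y ^ maxDegree W ∂Measure.pi Q.sideLaw ≤ 1)
    (S : ∀ j, Finset (W j)) : |cubeForm F Q S| ≤ 1 + maxDegree W := by
  have h := (enorm_signedForm_le_completeForm (μ := Q.sideLaw) hF0
    (fun j => (Q.isSplit_sideLaw j).abs_sign) S).trans (completeForm_sideLaw_le i₀ hF hQ)
  have h' := ENNReal.toReal_mono (by simp) h
  rw [toReal_enorm, Real.norm_eq_abs] at h'
  refine h'.trans (le_of_eq ?_)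
  rw [ENNReal.toReal_add (by simp) (by simp)]
  simp

variable [∀ j, DecidableEq (W j)]

/-- The gains of the Bellman function are summable over the tree. -/
theorem sum_vol_mul_gain_le (hT : IsConvexTree T R) (hF : ∀ e, Measurable (F e))
    (hN : ∀ Q ∈ treeAndLeaves T, ∀ e,
      ∫⁻ y, ofRealFamily F e y ^ maxDegree W ∂Measure.pi Q.sideLaw ≤ 1)
    {i : Fin r} (hW : 2 ≤ Fintype.card (W i)) (u : W i) :
    (∀ Q ∈ T, bellmanGain (ofRealFamily F) Q.sideLaw i (Q.halfSideLaw i) u ≠ ∞) ∧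
    ∑ Q ∈ T, Q.vol * (bellmanGain (ofRealFamily F) Q.sideLaw i (Q.halfSideLaw i) u).toReal
      ≤ 2 * (bellmanBound W).toReal * R.vol := by
  have hr : r ≠ 0 := fun h => by subst h; exact i.elim0
  have hFm := measurable_ofRealFamily hF
  have hle : ∀ Q ∈ treeAndLeaves T,
      bellmanForm (ofRealFamily F) Q.sideLaw ≤ bellmanBound W := fun Q hQ =>
    bellmanForm_le i hFm _ (hN Q hQ)
  have hfin : ∀ Q ∈ treeAndLeaves T, bellmanForm (ofRealFamily F) Q.sideLaw ≠ ∞ := fun Q hQ =>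
    ne_top_of_le_ne_top (bellmanBound_ne_top W) (hle Q hQ)
  have hmem : ∀ Q ∈ T, Q ∈ treeAndLeaves T := fun Q hQ => subset_treeAndLeaves hQ
  have key : ∀ Q : DyadicCube r, 2 ^ r * (2 * bellmanForm (ofRealFamily F) Q.sideLaw
      + bellmanGain (ofRealFamily F) Q.sideLaw i (Q.halfSideLaw i) u)
      ≤ 2 * ∑ b : Fin r → Fin 2, bellmanForm (ofRealFamily F) (Q.child b).sideLaw := fun Q =>
    bellmanForm_add_gain_le_sum hFm Q.isSplit_sideLaw hW u
  have hrhs : ∀ Q ∈ T, 2 * ∑ b : Fin r → Fin 2, bellmanForm (ofRealFamily F) (Q.child b).sideLaw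
      ≠ ∞ := fun Q hQ => ENNReal.mul_ne_top (by simp)
    (ENNReal.sum_ne_top.2 fun b _ => hfin _ (child_mem_treeAndLeaves hQ b))
  have hgain : ∀ Q ∈ T,
      bellmanGain (ofRealFamily F) Q.sideLaw i (Q.halfSideLaw i) u ≠ ∞ := fun Q hQ hinf => by
    have := key Q
    rw [hinf, add_top, ENNReal.mul_top (by simp), top_le_iff] at this
    exact hrhs Q hQ this
  refine ⟨hgain, ?_⟩
  have htel := hT.sum_vol_mul_le hr (K := (bellmanBound W).toReal)
    (f := fun Q => (bellmanForm (ofRealFamily F) Q.sideLaw).toReal)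
    (g := fun Q => (bellmanGain (ofRealFamily F) Q.sideLaw i (Q.halfSideLaw i) u).toReal / 2)
    ENNReal.toReal_nonneg (fun Q hQ => ENNReal.toReal_mono (bellmanBound_ne_top W) (hle Q hQ)) (by
      intro Q hQ
      have h := ENNReal.toReal_mono (hrhs Q hQ) (key Q)
      rw [ENNReal.toReal_mul, ENNReal.toReal_add
        (ENNReal.mul_ne_top (by simp) (hfin Q (hmem Q hQ))) (hgain Q hQ), ENNReal.toReal_mul,
        ENNReal.toReal_mul, ENNReal.toReal_sum fun b _ =>
          hfin _ (child_mem_treeAndLeaves hQ b)] at h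
      simp only [ENNReal.toReal_pow, ENNReal.toReal_ofNat] at h
      linarith)
  have e : ∑ Q ∈ T, Q.vol * ((bellmanGain (ofRealFamily F) Q.sideLaw i
      (Q.halfSideLaw i) u).toReal / 2) = (∑ Q ∈ T, Q.vol * (bellmanGain (ofRealFamily F) Q.sideLaw i
      (Q.halfSideLaw i) u).toReal) / 2 := by
    rw [Finset.sum_div]
    exact Finset.sum_congr rfl fun Q _ => by ring
  rw [e] at htel
  linarith

/-- If two vertices of one part are selected, the forms are absolutely summable over the tree. -/
theorem sum_vol_mul_abs_cubeForm_le (hT : IsConvexTree T R) (hF : ∀ e, Measurable (F e))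
    (hF0 : ∀ e y, 0 ≤ F e y)
    (hN : ∀ Q ∈ treeAndLeaves T, ∀ e,
      ∫⁻ y, ofRealFamily F e y ^ maxDegree W ∂Measure.pi Q.sideLaw ≤ 1)
    {S : ∀ j, Finset (W j)} {i : Fin r} (hS : 2 ≤ (S i).card) :
    ∑ Q ∈ T, Q.vol * |cubeForm F Q S| ≤ 4 * (bellmanBound W).toReal * R.vol := by
  obtain ⟨a, ha, b, hb, hab⟩ := Finset.one_lt_card.1 hS
  have hW : 2 ≤ Fintype.card (W i) := hS.trans (Finset.card_le_univ _)
  obtain ⟨hfa, ha'⟩ := sum_vol_mul_gain_le hT hF hN hW a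
  obtain ⟨hfb, hb'⟩ := sum_vol_mul_gain_le hT hF hN hW b
  have h : ∀ Q ∈ T, |cubeForm F Q S|
      ≤ (bellmanGain (ofRealFamily F) Q.sideLaw i (Q.halfSideLaw i) a).toReal
        + (bellmanGain (ofRealFamily F) Q.sideLaw i (Q.halfSideLaw i) b).toReal := fun Q hQ => by
    have h1 := ENNReal.toReal_mono (ENNReal.add_ne_top.2 ⟨hfa Q hQ, hfb Q hQ⟩)
      (enorm_signedForm_le_gain_add_gain hF hF0 Q.isSplit_sideLaw ha hb hab)
    rwa [toReal_enorm, Real.norm_eq_abs, ENNReal.toReal_add (hfa Q hQ) (hfb Q hQ)] at h1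
  calc _ ≤ ∑ Q ∈ T, Q.vol * ((bellmanGain (ofRealFamily F) Q.sideLaw i (Q.halfSideLaw i) a).toReal
        + (bellmanGain (ofRealFamily F) Q.sideLaw i (Q.halfSideLaw i) b).toReal) :=
      Finset.sum_le_sum fun Q hQ => mul_le_mul_of_nonneg_left (h Q hQ) Q.vol_pos.le
    _ ≤ _ := by
      simp only [mul_add, Finset.sum_add_distrib]
      linarith

/-- If a vertex is selected in a part with several vertices, the forms are square summable. -/
theorem sum_vol_mul_sq_cubeForm_le_of_two_le (hT : IsConvexTree T R) (hF : ∀ e, Measurable (F e))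
    (hF0 : ∀ e y, 0 ≤ F e y)
    (hN : ∀ Q ∈ treeAndLeaves T, ∀ e,
      ∫⁻ y, ofRealFamily F e y ^ maxDegree W ∂Measure.pi Q.sideLaw ≤ 1)
    {S : ∀ j, Finset (W j)} {i : Fin r} (hS : (S i).Nonempty) (hW : 2 ≤ Fintype.card (W i)) :
    ∑ Q ∈ T, Q.vol * cubeForm F Q S ^ 2 ≤ 2 * (bellmanBound W).toReal ^ 2 * R.vol := by
  obtain ⟨a, ha⟩ := hS
  obtain ⟨hfa, ha'⟩ := sum_vol_mul_gain_le hT hF hN hW a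
  have h : ∀ Q ∈ T, cubeForm F Q S ^ 2
      ≤ (bellmanGain (ofRealFamily F) Q.sideLaw i (Q.halfSideLaw i) a).toReal
        * (bellmanBound W).toReal := fun Q hQ => by
    have h0 := bellmanForm_le i (measurable_ofRealFamily hF) Q.sideLaw
      (hN Q (subset_treeAndLeaves hQ))
    have h1 := ENNReal.toReal_mono (ENNReal.mul_ne_top (hfa Q hQ) (bellmanBound_ne_top W))
      ((enorm_signedForm_sq_le_gain_mul hF hF0 Q.isSplit_sideLaw hW ha).trans
        (mul_le_mul_right h0 _))
    rwa [ENNReal.toReal_pow, toReal_enorm, Real.norm_eq_abs, sq_abs, ENNReal.toReal_mul] at h1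
  calc _ ≤ ∑ Q ∈ T, Q.vol * ((bellmanGain (ofRealFamily F) Q.sideLaw i
        (Q.halfSideLaw i) a).toReal * (bellmanBound W).toReal) :=
      Finset.sum_le_sum fun Q hQ => mul_le_mul_of_nonneg_left (h Q hQ) Q.vol_pos.le
    _ = (∑ Q ∈ T, Q.vol * (bellmanGain (ofRealFamily F) Q.sideLaw i
        (Q.halfSideLaw i) a).toReal) * (bellmanBound W).toReal := by
      rw [Finset.sum_mul]
      exact Finset.sum_congr rfl fun Q _ => by ring
    _ ≤ _ := by
      refine (mul_le_mul_of_nonneg_right ha' ENNReal.toReal_nonneg).trans (le_of_eq ?_)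
      ring

/-- If all selected vertices lie in parts with a single vertex, the forms are square summable. Here
the square of the form without selected vertices telescopes. -/
theorem sum_vol_mul_sq_cubeForm_le_of_card_le_one (hT : IsConvexTree T R)
    (hF : ∀ e, Measurable (F e)) (hF0 : ∀ e y, 0 ≤ F e y)
    (hN : ∀ Q ∈ treeAndLeaves T, ∀ e,
      ∫⁻ y, ofRealFamily F e y ^ maxDegree W ∂Measure.pi Q.sideLaw ≤ 1)
    {S : ∀ j, Finset (W j)} (hS : ∀ j, (S j).Nonempty → Fintype.card (W j) ≤ 1) {i : Fin r}
    (hi : (S i).Nonempty) :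
    ∑ Q ∈ T, Q.vol * cubeForm F Q S ^ 2 ≤ ((1 + maxDegree W) ^ 2 + 16 * (1 + maxDegree W) *
      Fintype.card (∀ j, Finset (W j)) * (bellmanBound W).toReal) * R.vol := by
  classical
  have hr : r ≠ 0 := fun h => by subst h; exact i.elim0
  set K : ℝ := 1 + maxDegree W with hK
  have hK0 : 0 ≤ K := by positivity
  have habs : ∀ Q ∈ treeAndLeaves T, ∀ U, |cubeForm F Q U| ≤ K := fun Q hQ =>
    abs_cubeForm_le i hF hF0 (hN Q hQ)
  have hsig : ∀ (Q : DyadicCube r) (σ : Fin r → ℝ → ℝ),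
      signedForm F Q.sideLaw σ (fun _ => ∅) = cubeForm F Q fun _ => ∅ := fun Q σ => by
    simp [cubeForm, signedForm, signedIntegrand]
  have htel := hT.sum_vol_mul_le hr (K := K ^ 2) (f := fun Q => cubeForm F Q (fun _ => ∅) ^ 2)
    (g := fun Q => cubeForm F Q S ^ 2 - 4 * K * multiForm F Q.sideLaw Q.sideSign)
    (sq_nonneg _) (fun Q hQ => sq_le_sq' (abs_le.1 (habs Q hQ _)).1 (abs_le.1 (habs Q hQ _)).2) (by
      intro Q hQ
      have hQ' : Q ∈ treeAndLeaves T := subset_treeAndLeaves hQ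
      have h := sq_add_sq_le_sum_children hF hF0 Q.isSplit_sideLaw
        (completeForm_sideLaw_ne_top i hF (hN Q hQ')) hS hi (habs Q hQ')
      simp only [← Q.sideLaw_child, hsig] at h
      exact h)
  have hmulti : ∑ Q ∈ T, Q.vol * multiForm F Q.sideLaw Q.sideSign
      ≤ Fintype.card (∀ j, Finset (W j)) * (4 * (bellmanBound W).toReal * R.vol) := by
    simp only [multiForm, Finset.mul_sum]
    rw [Finset.sum_comm, ← nsmul_eq_mul, ← Finset.card_univ]
    refine (Finset.sum_le_card_nsmul _ _ (4 * (bellmanBound W).toReal * R.vol) fun U hU => ?_).trans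
      (nsmul_le_nsmul_left (by have := R.vol_pos; positivity) (Finset.card_filter_le _ _))
    obtain ⟨j, hj⟩ := (Finset.mem_filter.1 hU).2
    exact sum_vol_mul_abs_cubeForm_le hT hF hF0 hN hj
  have e : ∑ Q ∈ T, Q.vol * (cubeForm F Q S ^ 2 - 4 * K * multiForm F Q.sideLaw Q.sideSign)
      = ∑ Q ∈ T, Q.vol * cubeForm F Q S ^ 2
        - 4 * K * ∑ Q ∈ T, Q.vol * multiForm F Q.sideLaw Q.sideSign := by
    rw [Finset.mul_sum, ← Finset.sum_sub_distrib]
    exact Finset.sum_congr rfl fun Q _ => by ring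
  rw [e] at htel
  have h4 := mul_le_mul_of_nonneg_left hmulti (by positivity : 0 ≤ 4 * K)
  linarith

omit [∀ j, DecidableEq (W j)] in
variable (W) in
/-- The estimates for a complete hypergraph and functions with normalized moments: the forms are
bounded, absolutely summable over the tree if two vertices in the same part are selected, and square
summable if a vertex is selected. -/
theorem exists_complete_tree_bound (i₀ : Fin r) : ∃ C : ℝ, 0 ≤ C ∧
    ∀ (T : Finset (DyadicCube r)) (R : DyadicCube r), IsConvexTree T R →
    ∀ F : (∀ j, W j) → (Fin r → ℝ) → ℝ, (∀ e, Measurable (F e)) → (∀ e y, 0 ≤ F e y) →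
    (∀ Q ∈ treeAndLeaves T, ∀ e,
      ∫⁻ y, ofRealFamily F e y ^ maxDegree W ∂Measure.pi Q.sideLaw ≤ 1) →
    ∀ S : ∀ j, Finset (W j),
      (∀ Q ∈ T, |cubeForm F Q S| ≤ C) ∧
      ((∃ j, 2 ≤ (S j).card) → ∑ Q ∈ T, Q.vol * |cubeForm F Q S| ≤ C * R.vol) ∧
      ((∃ j, (S j).Nonempty) → ∑ Q ∈ T, Q.vol * cubeForm F Q S ^ 2 ≤ C * R.vol) := by
  classical
  set B := (bellmanBound W).toReal
  have hB : 0 ≤ B := ENNReal.toReal_nonneg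
  set C₁ : ℝ := 1 + maxDegree W
  set C₂ : ℝ := 4 * B
  set C₃ : ℝ := 2 * B ^ 2
  set C₄ : ℝ := (1 + maxDegree W) ^ 2 + 16 * (1 + maxDegree W) *
      Fintype.card (∀ j, Finset (W j)) * B
  have h1 : 0 ≤ C₁ := by positivity
  have h2 : 0 ≤ C₂ := by positivity
  have h3 : 0 ≤ C₃ := by positivity
  have h4 : 0 ≤ C₄ := by positivity
  refine ⟨C₁ + C₂ + C₃ + C₄, by positivity, fun T R hT F hF hF0 hN S => ⟨?_, ?_, ?_⟩⟩
  · intro Q hQ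
    exact (abs_cubeForm_le i₀ hF hF0 (hN Q (subset_treeAndLeaves hQ)) S).trans
      (by linarith)
  · rintro ⟨j, hj⟩
    exact (sum_vol_mul_abs_cubeForm_le hT hF hF0 hN hj).trans
      (mul_le_mul_of_nonneg_right (by linarith) R.vol_pos.le)
  · rintro ⟨i, hi⟩
    by_cases hS : ∃ j, (S j).Nonempty ∧ 2 ≤ Fintype.card (W j)
    · obtain ⟨j, hj, hW⟩ := hS
      exact (sum_vol_mul_sq_cubeForm_le_of_two_le hT hF hF0 hN hj hW).trans
        (mul_le_mul_of_nonneg_right (by linarith) R.vol_pos.le)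
    · push Not at hS
      exact (sum_vol_mul_sq_cubeForm_le_of_card_le_one hT hF hF0 hN
        (fun j hj => Nat.lt_succ_iff.1 (hS j hj)) hi).trans
        (mul_le_mul_of_nonneg_right (by linarith) R.vol_pos.le)

end CompleteTree

/-! ### Connected components -/

section Components

open scoped ENNReal

variable {r : ℕ} {n : Fin r → ℕ} (E : Finset (Edge n))

theorem OnCommonEdge.symm {E : Finset (Edge n)} {u v : Vertex n} (h : OnCommonEdge E u v) :
    OnCommonEdge E v u := by
  obtain ⟨e, he, h1, h2⟩ := h
  exact ⟨e, he, h2, h1⟩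

/-- The connected components of a hypergraph, as the classes of an equivalence relation. -/
def componentSetoid : Setoid (Vertex n) where
  r := SameComponent E
  iseqv :=
    { refl := fun _ => Relation.ReflTransGen.refl
      symm := fun h =>
        have : Std.Symm (OnCommonEdge E) := ⟨fun _ _ => OnCommonEdge.symm⟩
        (Relation.ReflTransGen.stdSymm (r := OnCommonEdge E)).symm _ _ h
      trans := Relation.ReflTransGen.trans }

/-- The type of connected components. -/
abbrev Component : Type := Quotient (componentSetoid E)

noncomputable instance : Fintype (Component E) := by
  classical
  exact Quotient.fintype _

noncomputable instance : DecidableEq (Component E) := Classical.decEq _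

/-- The connected component of a vertex. -/
def componentOf (v : Vertex n) : Component E := Quotient.mk (componentSetoid E) v

/-- The vertices of the `j`-th part in a given connected component. -/
abbrev CompPart (A : Component E) (j : Fin r) : Type := {v : Fin (n j) // componentOf E ⟨j, v⟩ = A}

variable {E} in
theorem componentOf_eq_iff {u v : Vertex n} :
    componentOf E u = componentOf E v ↔ SameComponent E u v :=
  Quotient.eq (r := componentSetoid E)

variable {E} in
theorem componentOf_edge {e : Edge n} (he : e ∈ E) (i j : Fin r) :
    componentOf E ⟨i, e i⟩ = componentOf E ⟨j, e j⟩ :=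
  componentOf_eq_iff.2 (Relation.ReflTransGen.single ⟨e, he, rfl, rfl⟩)

variable {E} in
/-- An edge of the complete hypergraph on a component, as a possible edge of the original one. -/
def compEdge {A : Component E} (e : ∀ j, CompPart E A j) : Edge n := fun j => (e j).1

theorem threshold_compEdge {A : Component E} (e : ∀ j, CompPart E A j) :
    threshold E (compEdge e) = maxDegree (CompPart E A) := by
  unfold threshold maxDegree
  have : ∀ j, (componentPart E (compEdge e) j).ncard = Fintype.card (CompPart E A j) := fun j => by
    rw [← Nat.card_eq_fintype_card, ← Nat.card_coe_set_eq]
    refine Nat.card_congr (Equiv.subtypeEquivRight fun v => ?_)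
    change SameComponent E ⟨j, (e j).1⟩ ⟨j, v⟩ ↔ _
    rw [← componentOf_eq_iff, (e j).2, eq_comm]
  simp only [this]

open Classical in
/-- The family `F`, completed by the constant `1` to a family on the complete hypergraph with the
vertices of one component. -/
noncomputable def compFamily (F : Edge n → (Fin r → ℝ) → ℝ) (A : Component E)
    (e : ∀ j, CompPart E A j) (y : Fin r → ℝ) : ℝ :=
  if compEdge e ∈ E then F (compEdge e) y else 1

/-- The selected vertices in a component. -/
noncomputable def compSelection (S : ∀ i, Finset (Fin (n i))) (A : Component E) (j : Fin r) :
    Finset (CompPart E A j) :=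
  (S j).subtype _

/-- The product of the functions and of the signs of the selected variables on a cube. -/
noncomputable def globalIntegrand (S : ∀ i, Finset (Fin (n i))) (F : Edge n → (Fin r → ℝ) → ℝ)
    (Q : DyadicCube r) (x : Vertex n → ℝ) : ℝ :=
  (∏ e ∈ E, F e (fun i => x ⟨i, e i⟩)) * ∏ i, ∏ v ∈ S i, Q.sideSign i (x ⟨i, v⟩)

/-- Every edge lies in exactly one component; the index `i₀` only witnesses that edges are not
empty. -/
theorem prod_edges_eq_prod_components (i₀ : Fin r) (F : Edge n → (Fin r → ℝ) → ℝ)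
    (x : Vertex n → ℝ) :
    ∏ e ∈ E, F e (fun i => x ⟨i, e i⟩)
      = ∏ A, ∏ e, compFamily E F A e (fun j => x ⟨j, (e j).1⟩) := by
  classical
  unfold compFamily
  rw [← Fintype.prod_sigma' fun (A : Component E) (e : ∀ j, CompPart E A j) =>
      if compEdge e ∈ E then F (compEdge e) (fun j => x ⟨j, (e j).1⟩) else 1,
    ← Finset.prod_filter (fun p : Σ A : Component E, ∀ j, CompPart E A j => compEdge p.2 ∈ E)
      fun p => F (compEdge p.2) (fun j => x ⟨j, (p.2 j).1⟩)]
  symm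
  refine Finset.prod_bij (fun p _ => compEdge p.2) ?_ ?_ ?_ ?_
  · intro p hp
    exact (Finset.mem_filter.1 hp).2
  · rintro ⟨A, e⟩ - ⟨A', e'⟩ - h
    have h1 : ∀ j, (e j).1 = (e' j).1 := fun j => congrFun h j
    have hA : A = A' := by rw [← (e i₀).2, ← (e' i₀).2, h1]
    subst hA
    congr 1
    exact funext fun j => Subtype.ext (h1 j)
  · intro e he
    exact ⟨⟨componentOf E ⟨i₀, e i₀⟩, fun j => ⟨e j, componentOf_edge he j i₀⟩⟩,
      Finset.mem_filter.2 ⟨Finset.mem_univ _, he⟩, rfl⟩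
  · intro p _
    rfl

theorem globalIntegrand_eq_prod (i₀ : Fin r) (S : ∀ i, Finset (Fin (n i)))
    (F : Edge n → (Fin r → ℝ) → ℝ) (Q : DyadicCube r) (x : Vertex n → ℝ) :
    globalIntegrand E S F Q x = ∏ A, signedIntegrand (compFamily E F A) Q.sideSign
      (compSelection E S A) fun j v => x ⟨j, v.1⟩ := by
  unfold globalIntegrand signedIntegrand
  rw [Finset.prod_mul_distrib, prod_edges_eq_prod_components E i₀]
  congr 1
  rw [Finset.prod_comm (s := (Finset.univ : Finset (Component E)))]
  refine Finset.prod_congr rfl fun j _ => ?_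
  rw [← Finset.prod_fiberwise (S j) fun v => componentOf E ⟨j, v⟩]
  refine Finset.prod_congr rfl fun A _ => ?_
  unfold compSelection
  rw [← Finset.prod_subtype_eq_prod_filter]

/-- The variables of the different components are independent. -/
theorem measurePreserving_components (μ : Fin r → Measure ℝ) [∀ j, IsProbabilityMeasure (μ j)] :
    MeasurePreserving (fun (x : Vertex n → ℝ) (A : Component E) (j : Fin r)
        (v : CompPart E A j) => x ⟨j, v.1⟩)
      (Measure.pi fun v : Vertex n => μ v.1)
      (Measure.pi fun A : Component E => vertexLaw (CompPart E A) μ) := by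
  have h1 := measurePreserving_comp_sigma (fun v : Vertex n => μ v.1)
    (fun p : Σ A : Component E, Σ j, CompPart E A j => (⟨p.2.1, p.2.2.1⟩ : Vertex n)) (by
      rintro ⟨A, j, v, hv⟩ ⟨A', j', v', hv'⟩ h
      simp only [Sigma.mk.injEq] at h
      obtain ⟨rfl, h⟩ := h
      obtain rfl := eq_of_heq h
      subst hv
      subst hv'
      rfl)
  have h2 := fun A : Component E => measurePreserving_comp_sigma
    (fun v : Σ j, CompPart E A j => μ v.1) (fun v => v) Function.injective_id
  exact (measurePreserving_pi _ _ h2).comp h1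

/-- The form of the hypergraph on a cube is the product of the forms of its components. -/
theorem integrable_and_integral_globalIntegrand (i₀ : Fin r) (S : ∀ i, Finset (Fin (n i)))
    (F : Edge n → (Fin r → ℝ) → ℝ) (Q : DyadicCube r)
    (hint : ∀ A, Integrable (signedIntegrand (compFamily E F A) Q.sideSign (compSelection E S A))
      (vertexLaw (CompPart E A) Q.sideLaw)) :
    Integrable (globalIntegrand E S F Q) (Measure.pi fun v : Vertex n => Q.sideLaw v.1) ∧
    ∫ x, globalIntegrand E S F Q x ∂(Measure.pi fun v : Vertex n => Q.sideLaw v.1)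
      = ∏ A, cubeForm (compFamily E F A) Q (compSelection E S A) := by
  have hp := measurePreserving_components E Q.sideLaw
  have hI := Integrable.fintype_prod_dep hint
  have heq : globalIntegrand E S F Q = (fun y : ∀ A j, CompPart E A j → ℝ =>
      ∏ A, signedIntegrand (compFamily E F A) Q.sideSign (compSelection E S A) (y A)) ∘
      fun (x : Vertex n → ℝ) A j v => x ⟨j, v.1⟩ :=
    funext fun x => globalIntegrand_eq_prod E i₀ S F Q x
  refine ⟨?_, ?_⟩
  · rw [heq]
    exact hp.integrable_comp_of_integrable hI
  · rw [heq]
    have h2 : AEStronglyMeasurable (fun y : ∀ A j, CompPart E A j → ℝ =>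
      ∏ A, signedIntegrand (compFamily E F A) Q.sideSign (compSelection E S A) (y A))
      (Measure.map (fun (x : Vertex n → ℝ) (A : Component E) (j : Fin r)
        (v : CompPart E A j) => x ⟨j, v.1⟩) (Measure.pi fun v : Vertex n => Q.sideLaw v.1)) := by
      rw [hp.map_eq]; exact hI.aestronglyMeasurable
    refine Eq.trans ?_ (integral_fintype_prod_eq_prod
      (fun A => signedIntegrand (compFamily E F A) Q.sideSign (compSelection E S A))
      (μ := fun A => vertexLaw (CompPart E A) Q.sideLaw))
    have h3 := integral_map hp.measurable.aemeasurable h2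
    rw [hp.map_eq] at h3
    exact h3.symm

theorem haarZero_of_mem {a b t : ℝ} (h : t ∈ Set.Ico a b) : haarZero a b t = (b - a)⁻¹ := by
  simp [haarZero, Set.indicator_of_mem h]

theorem haarZero_of_notMem {a b t : ℝ} (h : t ∉ Set.Ico a b) : haarZero a b t = 0 := by
  simp [haarZero, Set.indicator_of_notMem h]

theorem haarOne_of_mem {a b t : ℝ} (h : t ∈ Set.Ico a b) :
    haarOne a b t = (b - a)⁻¹ * halfSign a b t := by
  unfold haarOne halfSign
  congr 1
  by_cases h' : t < (a + b) / 2
  · rw [Set.indicator_of_mem (show t ∈ Set.Ico a ((a + b) / 2) from ⟨h.1, h'⟩),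
      Set.indicator_of_notMem fun hh => hh.1.not_gt h']
    simp [h']
  · rw [Set.indicator_of_mem (show t ∈ Set.Ico ((a + b) / 2) b from ⟨not_lt.1 h', h.2⟩),
      Set.indicator_of_notMem fun hh => h' hh.2]
    simp [h']

theorem haarOne_of_notMem {a b t : ℝ} (hab : a < b) (h : t ∉ Set.Ico a b) : haarOne a b t = 0 := by
  unfold haarOne
  rw [Set.indicator_of_notMem fun hh => h ⟨hh.1, hh.2.trans (by linarith)⟩,
    Set.indicator_of_notMem fun hh => h ⟨le_trans (by linarith) hh.1, hh.2⟩]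
  simp

/-- The values of the variables for which all edges lie in the cube. -/
def vertexBox (n : Fin r → ℕ) (Q : DyadicCube r) : Set (Vertex n → ℝ) :=
  Set.univ.pi fun v => Set.Ico (Q.lo v.1) (Q.hi v.1)

theorem evaluationIntegrand_eq_indicator (S : ∀ i, Finset (Fin (n i)))
    (F : Edge n → (Fin r → ℝ) → ℝ) (Q : DyadicCube r) (x : Vertex n → ℝ) :
    evaluationIntegrand E S F Q x = (∏ v : Vertex n, (Q.hi v.1 - Q.lo v.1)⁻¹) *
      (vertexBox n Q).indicator (globalIntegrand E S F Q) x := by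
  unfold evaluationIntegrand
  by_cases hx : x ∈ vertexBox n Q
  · have hx' : ∀ i (v : Fin (n i)), x ⟨i, v⟩ ∈ Set.Ico (Q.lo i) (Q.hi i) := fun i v =>
      hx ⟨i, v⟩ trivial
    rw [Set.indicator_of_mem hx, globalIntegrand, mul_left_comm]
    congr 1
    rw [Fintype.prod_sigma, ← Finset.prod_mul_distrib]
    refine Finset.prod_congr rfl fun i _ => ?_
    rw [Finset.prod_congr rfl fun v _ => haarOne_of_mem (hx' i v),
      Finset.prod_congr rfl fun v (_ : v ∈ (S i)ᶜ) => haarZero_of_mem (hx' i v),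
      Finset.prod_mul_distrib, mul_right_comm, Finset.prod_mul_prod_compl]
    rfl
  · rw [Set.indicator_of_notMem hx, mul_zero]
    simp only [vertexBox, Set.mem_pi, Set.mem_univ, true_imp_iff, not_forall] at hx
    obtain ⟨⟨i, v⟩, hv⟩ := hx
    refine mul_eq_zero_of_right _ (Finset.prod_eq_zero (Finset.mem_univ i) ?_)
    by_cases hS : v ∈ S i
    · exact mul_eq_zero_of_left
        (Finset.prod_eq_zero hS (haarOne_of_notMem (Q.lo_lt_hi i) hv)) _
    · exact mul_eq_zero_of_right _
        (Finset.prod_eq_zero (Finset.mem_compl.2 hS) (haarZero_of_notMem hv))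

/-- Integration against the Haar functions is integration with respect to the uniform law on the
cube of the functions and the signs. -/
theorem integrable_evaluationIntegrand (S : ∀ i, Finset (Fin (n i)))
    (F : Edge n → (Fin r → ℝ) → ℝ) (Q : DyadicCube r)
    (h : Integrable (globalIntegrand E S F Q) (Measure.pi fun v : Vertex n => Q.sideLaw v.1)) :
    Integrable (evaluationIntegrand E S F Q) ∧ evaluation E S F Q
      = ∫ x, globalIntegrand E S F Q x ∂(Measure.pi fun v : Vertex n => Q.sideLaw v.1) := by
  have hbox : MeasurableSet (vertexBox n Q) := MeasurableSet.univ_pi fun _ => measurableSet_Ico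
  have hlaw := pi_uniformLaw (ι := Vertex n) fun v => Q.lo_lt_hi v.1
  change (Measure.pi fun v : Vertex n => Q.sideLaw v.1)
    = _ • volume.restrict (vertexBox n Q) at hlaw
  have hne : ∏ v : Vertex n, ENNReal.ofReal (Q.hi v.1 - Q.lo v.1) ≠ 0 :=
    Finset.prod_ne_zero_iff.2 fun v _ => by simpa using Q.lo_lt_hi v.1
  have hfun := funext fun x => evaluationIntegrand_eq_indicator E S F Q x
  rw [hlaw] at h ⊢
  rw [integrable_smul_measure (ENNReal.inv_ne_zero.2 (ENNReal.prod_ne_top fun _ _ =>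
    ENNReal.ofReal_ne_top)) (ENNReal.inv_ne_top.2 hne)] at h
  constructor
  · rw [hfun]
    exact ((integrable_indicator_iff hbox).2 h).const_mul _
  · unfold evaluation
    rw [hfun, integral_const_mul, integral_indicator hbox, integral_smul_measure, smul_eq_mul,
      ENNReal.toReal_inv, ENNReal.toReal_prod, Finset.prod_inv_distrib]
    simp only [ENNReal.toReal_ofReal (sub_nonneg.2 (Q.lo_lt_hi _).le)]

/-- The estimate for functions with normalized moments. The form is a product over the connected
components; two selected vertices in the same part lie either in one component, whose forms are
absolutely summable, or in two components, whose forms are square summable. -/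
theorem exists_normalized_bound (i₀ : Fin r) : ∃ C : ℝ, 0 ≤ C ∧
    ∀ S : ∀ i, Finset (Fin (n i)), (∃ i, 2 ≤ (S i).card) →
    ∀ (T : Finset (DyadicCube r)) (R : DyadicCube r), IsConvexTree T R →
    ∀ F : Edge n → (Fin r → ℝ) → ℝ, (∀ e ∈ E, Measurable (F e)) → (∀ e ∈ E, ∀ y, 0 ≤ F e y) →
    (∀ Q ∈ treeAndLeaves T, ∀ e ∈ E,
      ∫⁻ y, ENNReal.ofReal (F e y) ^ threshold E e ∂Measure.pi Q.sideLaw ≤ 1) →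
    (∀ Q ∈ T, Integrable (evaluationIntegrand E S F Q)) ∧
      |treeForm E S T F| ≤ C * R.vol := by
  classical
  choose C hC0 hC using fun A : Component E => exists_complete_tree_bound (CompPart E A) i₀
  set D : ℝ := 1 + ∑ A, C A
  have hCD : ∀ A, C A ≤ D := fun A => by
    have := Finset.single_le_sum (fun A _ => hC0 A) (Finset.mem_univ A)
    linarith
  have hD1 : 1 ≤ D := by
    have := Finset.sum_nonneg fun A (_ : A ∈ Finset.univ) => hC0 A
    linarith
  have hD0 : 0 ≤ D := zero_le_one.trans hD1
  set N := Fintype.card (Component E)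
  refine ⟨D ^ N * (2 * D), by positivity, fun S hS T R hT F hF hF0 hN => ?_⟩
  have hFm : ∀ A e, Measurable (compFamily E F A e) := fun A e => by
    unfold compFamily
    split_ifs with he
    exacts [hF _ he, measurable_const]
  have hFn : ∀ A e y, 0 ≤ compFamily E F A e y := fun A e y => by
    unfold compFamily
    split_ifs with he
    exacts [hF0 _ he y, zero_le_one]
  have hFN : ∀ A, ∀ Q ∈ treeAndLeaves T, ∀ e, ∫⁻ y, ofRealFamily (compFamily E F A) e y ^
      maxDegree (CompPart E A) ∂Measure.pi Q.sideLaw ≤ 1 := fun A Q hQ e => by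
    unfold ofRealFamily compFamily
    split_ifs with he
    · rw [← threshold_compEdge E e]
      exact hN Q hQ _ he
    · simp
  have key := fun A => hC A T R hT _ (hFm A) (hFn A) (hFN A) (compSelection E S A)
  have hev : ∀ Q ∈ T, Integrable (evaluationIntegrand E S F Q) ∧
      evaluation E S F Q = ∏ A, cubeForm (compFamily E F A) Q (compSelection E S A) := by
    intro Q hQ
    obtain ⟨h1, h2⟩ := integrable_and_integral_globalIntegrand E i₀ S F Q fun A =>
      integrable_signedIntegrand (hFm A) (hFn A) (fun j => (Q.isSplit_sideLaw j).measurable)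
        (fun j => (Q.isSplit_sideLaw j).abs_sign)
        (completeForm_sideLaw_ne_top i₀ (hFm A) (hFN A Q (subset_treeAndLeaves hQ))) _
    obtain ⟨h3, h4⟩ := integrable_evaluationIntegrand E S F Q h1
    exact ⟨h3, h4.trans h2⟩
  refine ⟨fun Q hQ => (hev Q hQ).1, ?_⟩
  set c : Component E → DyadicCube r → ℝ := fun A Q =>
    cubeForm (compFamily E F A) Q (compSelection E S A)
  have hcD : ∀ A, ∀ Q ∈ T, |c A Q| ≤ D := fun A Q hQ => ((key A).1 Q hQ).trans (hCD A)
  have hrest : ∀ s : Finset (Component E), ∀ Q ∈ T, ∏ A ∈ s, |c A Q| ≤ D ^ N := fun s Q hQ =>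
    (Finset.prod_le_prod (fun _ _ => abs_nonneg _) fun A _ => hcD A Q hQ).trans (by
      rw [Finset.prod_const]
      exact pow_le_pow_right₀ hD1 (Finset.card_le_univ s))
  have hvolR := R.vol_pos.le
  -- It suffices to dominate the product by one summable quantity.
  have fin : ∀ g : DyadicCube r → ℝ, (∀ Q ∈ T, ∏ A, |c A Q| ≤ D ^ N * g Q) →
      ∑ Q ∈ T, Q.vol * g Q ≤ 2 * D * R.vol → |treeForm E S T F| ≤ D ^ N * (2 * D) * R.vol := by
    intro g hg hsum
    unfold treeForm
    calc _ ≤ ∑ Q ∈ T, |Q.vol * evaluation E S F Q| := Finset.abs_sum_le_sum_abs _ _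
      _ ≤ ∑ Q ∈ T, Q.vol * (D ^ N * g Q) := by
        refine Finset.sum_le_sum fun Q hQ => ?_
        rw [abs_mul, abs_of_pos Q.vol_pos, (hev Q hQ).2, Finset.abs_prod]
        exact mul_le_mul_of_nonneg_left (hg Q hQ) Q.vol_pos.le
      _ = D ^ N * ∑ Q ∈ T, Q.vol * g Q := by
        rw [Finset.mul_sum]
        exact Finset.sum_congr rfl fun Q _ => by ring
      _ ≤ D ^ N * (2 * D * R.vol) := mul_le_mul_of_nonneg_left hsum (by positivity)
      _ = _ := by ring
  obtain ⟨i, hi⟩ := hS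
  obtain ⟨a, ha, b, hb, hab⟩ := Finset.one_lt_card.1 hi
  have hmem : ∀ v ∈ S i, (⟨v, rfl⟩ : CompPart E (componentOf E ⟨i, v⟩) i)
      ∈ compSelection E S (componentOf E ⟨i, v⟩) i := fun v hv => by
    unfold compSelection
    exact Finset.mem_subtype.2 hv
  set A := componentOf E ⟨i, a⟩ with hA
  set B := componentOf E ⟨i, b⟩ with hB
  by_cases hAB : A = B
  · refine fin (fun Q => |c A Q|) (fun Q hQ => ?_) ?_
    · rw [← Finset.prod_erase_mul Finset.univ _ (Finset.mem_univ A)]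
      exact mul_le_mul_of_nonneg_right (hrest _ Q hQ) (abs_nonneg _)
    · have htwo : 2 ≤ (compSelection E S A i).card := by
        refine Finset.one_lt_card.2 ⟨⟨a, rfl⟩, hmem a ha, ⟨b, hAB.symm⟩, ?_, fun h => hab ?_⟩
        · unfold compSelection
          exact Finset.mem_subtype.2 hb
        · exact congrArg Subtype.val h
      refine ((key A).2.1 ⟨i, htwo⟩).trans (mul_le_mul_of_nonneg_right ?_ hvolR)
      linarith [hCD A]
  · refine fin (fun Q => c A Q ^ 2 + c B Q ^ 2) (fun Q hQ => ?_) ?_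
    · rw [← Finset.prod_erase_mul Finset.univ _ (Finset.mem_univ A),
        ← Finset.prod_erase_mul (Finset.univ.erase A) _
          (Finset.mem_erase.2 ⟨Ne.symm hAB, Finset.mem_univ B⟩), mul_assoc]
      refine mul_le_mul (hrest _ Q hQ) ?_ (by positivity) (by positivity)
      nlinarith [sq_nonneg (|c B Q| - |c A Q|), sq_abs (c A Q), sq_abs (c B Q),
        sq_nonneg (c A Q), sq_nonneg (c B Q)]
    · simp only [mul_add, Finset.sum_add_distrib]
      have h1 := (key A).2.2 ⟨i, _, hmem a ha⟩
      have h2 := (key B).2.2 ⟨i, _, hmem b hb⟩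
      have h3 := mul_le_mul_of_nonneg_right (hCD A) hvolR
      have h4 := mul_le_mul_of_nonneg_right (hCD B) hvolR
      linarith

end Components

/-! ### Normalization -/

section Normalization

open scoped ENNReal

variable {r : ℕ} {n : Fin r → ℕ}

theorem threshold_ne_zero (i₀ : Fin r) (E : Finset (Edge n)) (e : Edge n) : threshold E e ≠ 0 := by
  refine (lt_of_lt_of_le (Finset.prod_pos fun j _ => ?_)
    (Finset.le_sup (f := fun i : Fin r => ∏ j ∈ Finset.univ.erase i, (componentPart E e j).ncard)
      (Finset.mem_univ i₀))).ne'
  exact (Set.ncard_pos (Set.toFinite _)).2 ⟨e j, Relation.ReflTransGen.refl⟩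

theorem pi_sideLaw (Q : DyadicCube r) :
    Measure.pi Q.sideLaw = (volume Q.toSet)⁻¹ • volume.restrict Q.toSet := by
  rw [Q.volume_toSet, Q.toSet_eq_pi]
  exact pi_uniformLaw fun i => Q.lo_lt_hi i

theorem setAverage_toSet (Q : DyadicCube r) (f : (Fin r → ℝ) → ℝ) :
    ⨍ x in Q.toSet, f x = ∫ x, f x ∂Measure.pi Q.sideLaw := by
  rw [average, pi_sideLaw, Measure.restrict_apply_univ]

theorem integrable_pi_sideLaw (Q : DyadicCube r) {f : (Fin r → ℝ) → ℝ}
    (hf : LocallyIntegrable f) : Integrable f (Measure.pi Q.sideLaw) := by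
  rw [pi_sideLaw]
  refine Integrable.smul_measure ?_ (ENNReal.inv_ne_top.2 ?_)
  · have hsub : Q.toSet ⊆ Set.Icc Q.lo Q.hi := fun x hx =>
      ⟨fun i => (hx i).1, fun i => (hx i).2.le⟩
    exact (hf.integrableOn_isCompact isCompact_Icc).mono_set hsub
  · rw [Q.volume_toSet]
    exact Finset.prod_ne_zero_iff.2 fun v _ => by simpa using Q.lo_lt_hi v

theorem lintegral_scaled_pow_le_one (Q : DyadicCube r) {f : (Fin r → ℝ) → ℝ} (hf0 : ∀ y, 0 ≤ f y)
    {d : ℕ} (hd : d ≠ 0) (hf : LocallyIntegrable fun y => f y ^ d) {L : ℝ} (hL : 0 < L)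
    (hfL : (⨍ y in Q.toSet, f y ^ d) ^ (1 / (d : ℝ)) ≤ L) :
    ∫⁻ y, ENNReal.ofReal (L⁻¹ * f y) ^ d ∂Measure.pi Q.sideLaw ≤ 1 := by
  have hint := integrable_pi_sideLaw Q hf
  have h0 : 0 ≤ ⨍ y in Q.toSet, f y ^ d := by
    rw [setAverage_toSet]
    exact integral_nonneg fun y => pow_nonneg (hf0 y) d
  have h1 : ⨍ y in Q.toSet, f y ^ d ≤ L ^ d := by
    rw [one_div] at hfL
    have := pow_le_pow_left₀ (Real.rpow_nonneg h0 _) hfL d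
    rwa [Real.rpow_inv_natCast_pow h0 hd] at this
  calc _ = ∫⁻ y, ENNReal.ofReal ((L⁻¹) ^ d * f y ^ d) ∂Measure.pi Q.sideLaw := by
        refine lintegral_congr fun y => ?_
        rw [← ENNReal.ofReal_pow (mul_nonneg (inv_nonneg.2 hL.le) (hf0 y)), mul_pow]
    _ = ENNReal.ofReal ((L⁻¹) ^ d * ⨍ y in Q.toSet, f y ^ d) := by
        rw [← ofReal_integral_eq_lintegral_ofReal (hint.const_mul _)
          (Filter.Eventually.of_forall fun y => mul_nonneg (by positivity) (pow_nonneg (hf0 y) d)),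
          integral_const_mul, setAverage_toSet]
    _ ≤ ENNReal.ofReal 1 := by
        refine ENNReal.ofReal_le_ofReal ?_
        rw [inv_pow, inv_mul_le_iff₀ (by positivity), mul_one]
        exact h1
    _ = 1 := ENNReal.ofReal_one

theorem evaluationIntegrand_scale (E : Finset (Edge n)) (S : ∀ i, Finset (Fin (n i)))
    (F : Edge n → (Fin r → ℝ) → ℝ) (Q : DyadicCube r) {L : Edge n → ℝ} (hL : ∀ e ∈ E, L e ≠ 0)
    (x : Vertex n → ℝ) : evaluationIntegrand E S F Q x
      = (∏ e ∈ E, L e) * evaluationIntegrand E S (fun e y => (L e)⁻¹ * F e y) Q x := by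
  unfold evaluationIntegrand
  rw [← mul_assoc, ← Finset.prod_mul_distrib]
  congr 1
  refine Finset.prod_congr rfl fun e he => ?_
  rw [mul_inv_cancel_left₀ (hL e he)]

end Normalization

end DyadicForm

theorem mainTheorem2 (r : ℕ) (n : Fin r → ℕ) :
    ∃ C : ℝ, 0 < C ∧
      ∀ (E : Finset (DyadicForm.Edge n)) (S : ∀ i, Finset (Fin (n i))),
        (∃ i₀, 2 ≤ (S i₀).card) →
      ∀ (T : Finset (DyadicForm.DyadicCube r)) (R : DyadicForm.DyadicCube r)
        (hT : DyadicForm.IsConvexTree T R) (F : DyadicForm.Edge n → (Fin r → ℝ) → ℝ),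
        (∀ e ∈ E, Measurable (F e)) →
        (∀ e ∈ E, ∀ x, 0 ≤ F e x) →
        (∀ e ∈ E, MeasureTheory.LocallyIntegrable
          (fun x => F e x ^ DyadicForm.threshold E e) MeasureTheory.volume) →
        (∀ Q ∈ T, MeasureTheory.Integrable (DyadicForm.evaluationIntegrand E S F Q)
          MeasureTheory.volume) ∧
        |DyadicForm.treeForm E S T F| ≤
          C * R.vol * ∏ e ∈ E,
            (DyadicForm.treeAndLeaves T).sup' hT.treeAndLeaves_nonempty (fun Q =>
              (⨍ x in Q.toSet, F e x ^ DyadicForm.threshold E e) ^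
                (1 / (DyadicForm.threshold E e : ℝ))) := by
  classical
  by_cases hr : Nonempty (Fin r)
  swap
  -- For `r = 0` there is no part in which two vertices could be selected.
  · exact ⟨1, one_pos, fun E S hS => absurd ⟨hS.choose⟩ hr⟩
  obtain ⟨i₀⟩ := hr
  choose C hC0 hC using fun E : Finset (DyadicForm.Edge n) =>
    DyadicForm.exists_normalized_bound E i₀
  -- There are finitely many edge sets `E`, so the constant may depend on `E` at first.
  refine ⟨1 + ∑ E, C E, by have := Finset.sum_nonneg fun E (_ : E ∈ Finset.univ) => hC0 E; linarith,
    fun E S hS T R hT F hF hF0 hFi => ?_⟩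
  set D : ℝ := 1 + ∑ E, C E with hD
  have hCD : C E ≤ D := by
    have := Finset.single_le_sum (fun E _ => hC0 E) (Finset.mem_univ E)
    linarith
  set M : DyadicForm.Edge n → ℝ := fun e =>
    (DyadicForm.treeAndLeaves T).sup' hT.treeAndLeaves_nonempty (fun Q =>
      (⨍ x in Q.toSet, F e x ^ DyadicForm.threshold E e) ^ (1 / (DyadicForm.threshold E e : ℝ)))
  have hQM : ∀ e, ∀ Q ∈ DyadicForm.treeAndLeaves T,
      (⨍ x in Q.toSet, F e x ^ DyadicForm.threshold E e) ^ (1 / (DyadicForm.threshold E e : ℝ))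
        ≤ M e := fun e Q hQ =>
    Finset.le_sup' (fun Q : DyadicForm.DyadicCube r =>
      (⨍ x in Q.toSet, F e x ^ DyadicForm.threshold E e) ^
        (1 / (DyadicForm.threshold E e : ℝ))) hQ
  have hM0 : ∀ e ∈ E, 0 ≤ M e := fun e he => by
    refine le_trans (Real.rpow_nonneg ?_ _) (hQM e R (DyadicForm.subset_treeAndLeaves hT.root_mem))
    rw [DyadicForm.setAverage_toSet]
    exact MeasureTheory.integral_nonneg fun y => pow_nonneg (hF0 e he y) _
  -- The maxima may vanish, so the functions are divided by slightly larger numbers.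
  have key : ∀ η : ℝ, 0 < η →
      (∀ Q ∈ T, MeasureTheory.Integrable (DyadicForm.evaluationIntegrand E S F Q)) ∧
      |DyadicForm.treeForm E S T F| ≤ D * R.vol * ∏ e ∈ E, (M e + η) := by
    intro η hη
    have hL : ∀ e ∈ E, 0 < M e + η := fun e he => by linarith [hM0 e he]
    obtain ⟨h1, h2⟩ := hC E S hS T R hT (fun e y => (M e + η)⁻¹ * F e y)
      (fun e he => (hF e he).const_mul _)
      (fun e he y => mul_nonneg (inv_nonneg.2 (hL e he).le) (hF0 e he y))
      (fun Q hQ e he => DyadicForm.lintegral_scaled_pow_le_one Q (hF0 e he)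
        (DyadicForm.threshold_ne_zero i₀ E e) (hFi e he) (hL e he)
        ((hQM e Q hQ).trans (by linarith)))
    have hscale : ∀ Q, DyadicForm.evaluationIntegrand E S F Q = fun x => (∏ e ∈ E, (M e + η)) *
        DyadicForm.evaluationIntegrand E S (fun e y => (M e + η)⁻¹ * F e y) Q x := fun Q =>
      funext fun x => DyadicForm.evaluationIntegrand_scale E S F Q (fun e he => (hL e he).ne') x
    refine ⟨fun Q hQ => ?_, ?_⟩
    · rw [hscale]
      exact (h1 Q hQ).const_mul _
    · have hform : DyadicForm.treeForm E S T F = (∏ e ∈ E, (M e + η)) *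
          DyadicForm.treeForm E S T (fun e y => (M e + η)⁻¹ * F e y) := by
        unfold DyadicForm.treeForm DyadicForm.evaluation
        rw [Finset.mul_sum]
        refine Finset.sum_congr rfl fun Q _ => ?_
        rw [hscale, MeasureTheory.integral_const_mul]
        ring
      have hP : 0 ≤ ∏ e ∈ E, (M e + η) := Finset.prod_nonneg fun e he => (hL e he).le
      rw [hform, abs_mul, abs_of_nonneg hP, mul_comm]
      refine mul_le_mul_of_nonneg_right (h2.trans ?_) hP
      exact mul_le_mul_of_nonneg_right hCD R.vol_pos.le
  refine ⟨(key 1 one_pos).1, ?_⟩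
  have hlim : Filter.Tendsto (fun η : ℝ => D * R.vol * ∏ e ∈ E, (M e + η))
      (nhdsWithin 0 (Set.Ioi 0)) (nhds (D * R.vol * ∏ e ∈ E, (M e + 0))) := by
    have : Continuous fun η : ℝ => D * R.vol * ∏ e ∈ E, (M e + η) := by fun_prop
    exact (this.tendsto 0).mono_left nhdsWithin_le_nhds
  simp only [add_zero] at hlim
  exact ge_of_tendsto hlim (Filter.eventually_of_mem self_mem_nhdsWithin fun η hη => (key η hη).2)
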